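/- Let $\alpha>0$, $\lambda>0$ and $H=\alpha+\frac12$. Let $\{Z_j\}_{j\in\mathbb Z}$ be i.i.d. real random variables with mean zero and finite variance. For $n\ge 1$ let $X_k^{\lambda/n}$ be the ARTFIMA$(0,\alpha,\lambda/n,0)$ series $$X_k^{\lambda/n}=\sum_{j=0}^{\infty}(-1)^j\binom{-\alpha}{j}e^{-\lambda j/n}\,Z_{k-j},\qquad k\in\mathbb Z,$$ where $\binom{-\alpha}{j}$ is the generalised binomial coefficient, and let $$T_n^{\lambda/n}(t)=\sum_{k=1}^{[t]}X_k^{\lambda/n}+(t-[t])\,X_{[t]+1}^{\lambda/n},\qquad t\ge0,$$ be its linearly interpolated partial sum. Let $B(dy)$ be an independently scattered Gaussian random measure on $\mathbb R$ with control measure $\sigma^2\,dy$, where $\sigma^2=\operatorname{Var}(Z_0)/\Gamma(\alpha)^2$, and let $$Z^1_{H,\lambda}(t)=\int_{\mathbb R}\int_0^t (s-y)^{H-\frac32}e^{-\lambda (s-y)}\mathbf 1_{\{s>y\}}\,ds\,B(dy)$$ be the tempered Hermite process of order one driven by $B$. (Equivalently, $Z^1_{H,\lambda}$ is $1/\Gamma(\alpha)$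 times the tempered Hermite process with control measure $\operatorname{Var}(Z_0)\,dy$.) Then, for every $n\ge1$, the series defining $X_k^{\lambda/n}$ converge absolutely with probability one; the process $Z^1_{H,\lambda}$ has a version with continuous paths on $[0,1]$; and, for every such version, $$n^{-H}\,T_n^{\lambda/n}(nt)\;\Rightarrow\; Z^1_{H,\lambda}(t)\qquad (n\to\infty)$$ weakly in $C[0,1]$, the space of continuous functions on $[0,1]$ with the uniform norm and its Borel $\sigma$-algebra. -/

import Mathlib

open MeasureTheory ProbabilityTheory Filter Topology

noncomputable section

namespace TemperedFractional

/-! ### The tempered fractional difference operator and the ARTFIMA series -/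

/-- The coefficient `(-1)^j * binom(a, j) * e^(-lam * j)`, with the generalised binomial
coefficient `binom(a, j) = a (a - 1) ⋯ (a - j + 1) / j!`, which makes sense for every real `a`. -/
def coeff (a lam : ℝ) (j : ℕ) : ℝ :=
  (-1) ^ j * Ring.choose a j * Real.exp (-(lam * j))

/-- The tempered fractional difference operator of order `a` and step `1`,
`(Δ^{a,lam} f)(k) = ∑_{j ≥ 0} (-1)^j binom(a, j) e^(-lam j) f(k - j)`. -/
def temperedDiff (a lam : ℝ) (f : ℤ → ℝ) (k : ℤ) : ℝ :=
  ∑' j : ℕ, coeff a lam j * f (k - j)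

/-- The ARTFIMA `(0, α, lam, 0)` series driven by the noise `Z`: `X = Δ^{-α,lam} Z`. -/
def artfima {Ω : Type*} (α lam : ℝ) (Z : ℤ → Ω → ℝ) (k : ℤ) (ω : Ω) : ℝ :=
  temperedDiff (-α) lam (fun i => Z i ω) k

/-! ### Linearly interpolated partial sums -/

/-- `∑_{k=1}^{[t]} x_k + (t - [t]) x_{[t]+1}` (used for `t ≥ 0`). -/
def partialSum (x : ℤ → ℝ) (t : ℝ) : ℝ :=
  ∑ k ∈ Finset.Icc 1 ⌊t⌋₊, x k + (t - ⌊t⌋₊) * x ((⌊t⌋₊ : ℤ) + 1)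

lemma partialSum_eq_on_Icc (x : ℤ → ℝ) (N : ℕ) (t : ℝ) (h1 : (N : ℝ) ≤ t) (h2 : t ≤ N + 1) :
    partialSum x t = ∑ k ∈ Finset.Icc 1 N, x k + (t - N) * x ((N : ℤ) + 1) := by
  rcases h2.lt_or_eq with h | h
  · have hf : ⌊t⌋₊ = N := (Nat.floor_eq_iff ((Nat.cast_nonneg N).trans h1)).2 ⟨h1, h⟩
    simp [partialSum, hf]
  · have hf : ⌊t⌋₊ = N + 1 := by
      rw [h]; exact_mod_cast Nat.floor_natCast (R := ℝ) (N + 1)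
    rw [partialSum, hf, Finset.sum_Icc_succ_top (by omega), h]
    push_cast
    ring

lemma continuousOn_partialSum (x : ℤ → ℝ) (N : ℕ) :
    ContinuousOn (partialSum x) (Set.Icc (0 : ℝ) N) := by
  induction N with
  | zero => simp
  | succ N ih =>
    have hN : (0 : ℝ) ≤ N := Nat.cast_nonneg N
    have hstep : ContinuousOn (partialSum x) (Set.Icc (N : ℝ) (N + 1)) := by
      refine ContinuousOn.congr
        (f := fun t => ∑ k ∈ Finset.Icc 1 N, x k + (t - N) * x ((N : ℤ) + 1)) ?_ ?_
      · fun_prop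
      · intro t ht
        exact partialSum_eq_on_Icc x N t ht.1 ht.2
    have := ih.union_of_isClosed hstep isClosed_Icc isClosed_Icc
    rwa [Set.Icc_union_Icc_eq_Icc hN (by linarith), ← Nat.cast_succ] at this

lemma continuous_partialSum_unitInterval (x : ℤ → ℝ) (n : ℕ) :
    Continuous fun t : unitInterval => partialSum x (n * (t : ℝ)) := by
  refine (continuousOn_partialSum x n).comp_continuous (by fun_prop) fun t => ?_
  have h0 := t.2.1
  have h1 := t.2.2
  have hn : (0 : ℝ) ≤ n := Nat.cast_nonneg n
  exact ⟨by positivity, by nlinarith⟩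

/-- The element `t ↦ n^(-H) * S(n t)` of `C[0,1]`, where `S` is the linearly interpolated
partial sum of the series `x`. -/
def scaledPath (H : ℝ) (n : ℕ) (x : ℤ → ℝ) : C(unitInterval, ℝ) where
  toFun t := (n : ℝ) ^ (-H) * partialSum x (n * (t : ℝ))
  continuous_toFun := continuous_const.mul (continuous_partialSum_unitInterval x n)

/-- `C[0,1]`, with the uniform topology, carries its Borel σ-algebra. -/
instance : MeasurableSpace C(unitInterval, ℝ) := borel _

instance : BorelSpace C(unitInterval, ℝ) := ⟨rfl⟩

/-! ### Gaussian random measures, the Wiener integral, the tempered Hermite process -/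

/-- `B` is an independently scattered Gaussian random measure on `ℝ` with control measure `m`,
under the probability measure `P`.  Only the values `B A` on Borel sets `A` with `m A < ∞`
matter; σ-additivity is in the sense of mean square convergence. -/
structure IsGaussianRandomMeasure {Ω : Type*} [MeasurableSpace Ω] (B : Set ℝ → Ω → ℝ)
    (m : Measure ℝ) (P : Measure Ω) : Prop where
  hasLaw : ∀ A, MeasurableSet A → m A < ⊤ → HasLaw (B A) (gaussianReal 0 (m A).toNNReal) P
  indep : ∀ A : ℕ → Set ℝ, (∀ i, MeasurableSet (A i)) → (∀ i, m (A i) < ⊤) →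
    Pairwise (Function.onFun Disjoint A) → iIndepFun (fun i => B (A i)) P
  additive : ∀ A : ℕ → Set ℝ, (∀ i, MeasurableSet (A i)) → m (⋃ i, A i) < ⊤ →
    Pairwise (Function.onFun Disjoint A) →
    Tendsto (fun N : ℕ => eLpNorm (fun ω => B (⋃ i, A i) ω - ∑ i ∈ Finset.range N, B (A i) ω) 2 P)
      atTop (𝓝 0)

/-- The integral of a simple function, `∑_c c * B(φ = c)`. -/
def simpleIntegral {Ω : Type*} (B : Set ℝ → Ω → ℝ) (φ : SimpleFunc ℝ ℝ) (ω : Ω) : ℝ :=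
  ∑ c ∈ φ.range, c * B (φ ⁻¹' {c}) ω

/-- `Y` is (a version of) the stochastic integral `∫ f dB`: `f ∈ L²(m)` and `Y` is the mean square
limit of the integrals of simple functions that converge to `f` in `L²(m)`. -/
def IsWienerIntegral {Ω : Type*} [MeasurableSpace Ω] (B : Set ℝ → Ω → ℝ) (m : Measure ℝ)
    (P : Measure Ω) (f : ℝ → ℝ) (Y : Ω → ℝ) : Prop :=
  MemLp f 2 m ∧ MemLp Y 2 P ∧
  ∃ φ : ℕ → SimpleFunc ℝ ℝ, (∀ i, MemLp (φ i) 2 m) ∧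
    Tendsto (fun i => eLpNorm (fun y => φ i y - f y) 2 m) atTop (𝓝 0) ∧
    Tendsto (fun i => eLpNorm (fun ω => simpleIntegral B (φ i) ω - Y ω) 2 P) atTop (𝓝 0)

/-- The kernel `y ↦ ∫_0^t (s - y)_+^(H - 3/2) e^(-lam (s - y)_+) ds`, where the integrand is
understood to vanish for `s ≤ y`. -/
def thpKernel (H lam t y : ℝ) : ℝ :=
  ∫ s in (0 : ℝ)..t,
    if 0 < s - y then (s - y) ^ (H - 3 / 2) * Real.exp (-(lam * (s - y))) else 0

/-- `ζ` is a tempered Hermite process of order one on the time interval `[0,1]`, with continuous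
paths, driven by the random measure `B` with control measure `m`. -/
def IsTHP {Ω : Type*} [MeasurableSpace Ω] (B : Set ℝ → Ω → ℝ) (m : Measure ℝ) (P : Measure Ω)
    (H lam : ℝ) (ζ : Ω → C(unitInterval, ℝ)) : Prop :=
  ∀ t : unitInterval, IsWienerIntegral B m P (thpKernel H lam t) (fun ω => ζ ω t)

end TemperedFractional

end

noncomputable section

namespace TemperedFractional

/-! ### The Wiener integral -/

section WienerIntegral

variable {Ω : Type*} [MeasurableSpace Ω] {P : Measure Ω} {m : Measure ℝ} {B : Set ℝ → Ω → ℝ}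

/-! The interpolated partial sum is the integral of a step function, so the scaled path at time `t`
is a weighted sum of the noise, with weights `n^(-1/2) ∫_0^t g_n(⌊ns⌋ - (i - 1)) ds`, where `g_n`
(`stepKernel`) is the rescaled coefficient sequence. The factor `n^(-1/2)` is the square root of the
length of a cell of the grid of mesh `1/n`, so sums of squared weights are Lebesgue integrals of
squared step kernels, directly comparable with the `L²` norms of the limit kernel
(`tsum_enorm_sq_weight`).

Two facts about `g_n(⌊ns⌋ - ⌊ny⌋)` carry the analysis. Off the diagonal it converges to `Γ(α)⁻¹ (s -
y)_+^(α-1) e^(-lam (s - y))` (`tendsto_stepKernel`), and it is dominated, uniformly in `n`, by a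
translate `h(s - y)` of a function in `L¹ ∩ L^(1+α)` (`exists_enorm_stepKernel_le`). Dominated
convergence then gives convergence of the variances of all finite linear combinations in time. Since
the individual weights are `O(n^(-1/2))`, a Lindeberg-type central limit theorem for infinite
weighted sums (`tendsto_charFun_weighted_sum`) yields Gaussian limits of the finite-dimensional
distributions. The Wiener integral is linear and has a centred Gaussian law determined by the `L²`
norm of its integrand, which identifies these limits.

The same domination controls increments: in the square of an `L²` increment one factor is bounded by
Hölder, the other integrated by translation invariance, giving `C |t - s|^(1+κ)` with `κ > 0`,
uniformly in `n` and also for the limit (`exists_sq_increment_bound`). By chaining, the mean uniform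
distance between a path and its dyadic interpolation is bounded by a vanishing quantity depending
only on `C`, `κ` and the level. This gives the continuous version of the limit and replaces
tightness: bounded Lipschitz functionals are compared through interpolations, which depend on
finitely many times (`tendstoInDistribution_of_moment_bound`). -/

lemma IsGaussianRandomMeasure.memLp (hB : IsGaussianRandomMeasure B m P) {A : Set ℝ}
    (hA : MeasurableSet A) (hmA : m A < ⊤) : MemLp (B A) 2 P := by
  have h := hB.hasLaw A hA hmA
  have h2 : MemLp id 2 (P.map (B A)) := by
    rw [h.map_eq]; exact memLp_id_gaussianReal' 2 (by simp)
  exact (memLp_map_measure_iff aestronglyMeasurable_id h.aemeasurable).1 h2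

lemma IsGaussianRandomMeasure.empty_ae_eq_zero (hB : IsGaussianRandomMeasure B m P) :
    B ∅ =ᵐ[P] 0 := by
  have h := hB.hasLaw ∅ .empty (by simp)
  simp only [measure_empty, ENNReal.toNNReal_zero, gaussianReal_zero_var] at h
  have := (h.ae_iff (p := fun x => x = 0) (measurableSet_setOfPred.1 (measurableSet_singleton 0))).2 (by simp [ae_dirac_eq])
  simpa [Filter.EventuallyEq] using this

/-- Mean square σ-additivity is applied to `s, t, ∅, ∅, …`. From two terms on, the error no longer
depends on `N` almost surely, so its vanishing limit is its value. -/
lemma IsGaussianRandomMeasure.union_ae_eq (hB : IsGaussianRandomMeasure B m P) {s t : Set ℝ}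
    (hs : MeasurableSet s) (ht : MeasurableSet t) (hms : m s < ⊤) (hmt : m t < ⊤)
    (hst : Disjoint s t) : B (s ∪ t) =ᵐ[P] B s + B t := by
  set A : ℕ → Set ℝ := fun i => if i = 0 then s else if i = 1 then t else ∅ with hA
  have hU : ⋃ i, A i = s ∪ t := by
    ext x
    simp only [Set.mem_iUnion, Set.mem_union]
    constructor
    · rintro ⟨i, hi⟩
      by_cases h0 : i = 0
      · left; simpa [hA, h0] using hi
      · by_cases h1 : i = 1
        · right; simpa [hA, h1] using hi
        · simp [hA, h0, h1] at hi
    · rintro (h | h)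
      · exact ⟨0, by simpa [hA] using h⟩
      · exact ⟨1, by simpa [hA] using h⟩
  have hAm : ∀ i, MeasurableSet (A i) := by
    intro i; simp only [hA]; split_ifs <;> simp [hs, ht]
  have hdisj : Pairwise (Function.onFun Disjoint A) := by
    intro i j hij
    simp only [Function.onFun, hA]
    split_ifs <;> simp_all [disjoint_comm]
  have hadd := hB.additive A hAm (by rw [hU]; exact measure_union_lt_top hms hmt) hdisj
  rw [hU] at hadd
  have hev : ∀ᶠ N : ℕ in atTop,
      eLpNorm (fun ω => B (s ∪ t) ω - ∑ i ∈ Finset.range N, B (A i) ω) 2 P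
        = eLpNorm (B (s ∪ t) - (B s + B t)) 2 P := by
    filter_upwards [eventually_ge_atTop 2] with N hN
    apply eLpNorm_congr_ae
    filter_upwards [hB.empty_ae_eq_zero] with ω hω
    obtain ⟨M, rfl⟩ := Nat.exists_eq_add_of_le hN
    rw [add_comm, Finset.sum_range_succ', Finset.sum_range_succ']
    have : ∀ i, B (A (i + 1 + 1)) ω = 0 := by
      intro i; simpa [hA] using hω
    simp only [this, Finset.sum_const_zero]
    simp [hA]; ring
  have hlim := tendsto_nhds_unique (hadd.congr' hev) tendsto_const_nhds
  have hm : AEStronglyMeasurable (B (s ∪ t) - (B s + B t)) P :=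
    ((hB.memLp (hs.union ht) (measure_union_lt_top hms hmt)).sub
      ((hB.memLp hs hms).add (hB.memLp ht hmt))).1
  have := (eLpNorm_eq_zero_iff hm (by simp)).1 hlim.symm
  filter_upwards [this] with ω hω
  simpa [sub_eq_zero] using hω

open Classical in
/-- The values of a Gaussian random measure, as elements of `L²`. -/
def IsGaussianRandomMeasure.toLp (hB : IsGaussianRandomMeasure B m P) (A : Set ℝ) : Lp ℝ 2 P :=
  if h : MeasurableSet A ∧ m A < ⊤ then (hB.memLp h.1 h.2).toLp else 0

lemma IsGaussianRandomMeasure.coeFn_toLp (hB : IsGaussianRandomMeasure B m P) {A : Set ℝ}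
    (hA : MeasurableSet A) (hmA : m A < ⊤) : hB.toLp A =ᵐ[P] B A := by
  rw [IsGaussianRandomMeasure.toLp, dif_pos ⟨hA, hmA⟩]
  exact MemLp.coeFn_toLp _

/-- The values of a Gaussian random measure, as linear maps. -/
def IsGaussianRandomMeasure.toCLM (hB : IsGaussianRandomMeasure B m P) (A : Set ℝ) :
    ℝ →L[ℝ] Lp ℝ 2 P :=
  ContinuousLinearMap.toSpanSingleton ℝ (hB.toLp A)

/-- Additivity holds only almost surely for each pair of sets. Passing to classes in `L²` makes it
exact, so that the linearity of `SimpleFunc.setToSimpleFunc` applies. -/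
lemma IsGaussianRandomMeasure.finMeasAdditive (hB : IsGaussianRandomMeasure B m P) :
    FinMeasAdditive m hB.toCLM := by
  intro s t hs ht hms hmt hst
  have key : hB.toLp (s ∪ t) = hB.toLp s + hB.toLp t := by
    apply Lp.ext
    have h1 := hB.coeFn_toLp (hs.union ht) (measure_union_lt_top hms.lt_top hmt.lt_top)
    filter_upwards [h1, hB.coeFn_toLp hs hms.lt_top, hB.coeFn_toLp ht hmt.lt_top,
      Lp.coeFn_add (hB.toLp s) (hB.toLp t),
      hB.union_ae_eq hs ht hms.lt_top hmt.lt_top hst] with ω a1 a2 a3 a4 a5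
    rw [a1, a5, a4, Pi.add_apply, Pi.add_apply, a2, a3]
  ext1
  simp [IsGaussianRandomMeasure.toCLM, key]

lemma IsGaussianRandomMeasure.coeFn_setToSimpleFunc (hB : IsGaussianRandomMeasure B m P)
    {φ : SimpleFunc ℝ ℝ} (hφ : MemLp φ 2 m) :
    ((φ.setToSimpleFunc hB.toCLM : Lp ℝ 2 P) : Ω → ℝ) =ᵐ[P] simpleIntegral B φ := by
  have hfin : ∀ c : ℝ, c ≠ 0 → m (φ ⁻¹' {c}) < ⊤ := fun c hc =>
    SimpleFunc.measure_preimage_lt_top_of_memLp (by simp) (by simp) φ hφ c hc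
  have h1 : ∀ c : ℝ, (hB.toCLM (φ ⁻¹' {c}) c : Lp ℝ 2 P) =ᵐ[P] fun ω => c * B (φ ⁻¹' {c}) ω := by
    intro c
    -- The fibre over `0` may have infinite measure, where nothing is known about `B`; the
    -- coefficient `0` removes it.
    by_cases hc : c = 0
    · subst hc
      simp only [map_zero, zero_mul]
      exact Lp.coeFn_zero _ _ _
    · filter_upwards [Lp.coeFn_smul c (hB.toLp (φ ⁻¹' {c})),
        hB.coeFn_toLp (φ.measurableSet_fiber c) (hfin c hc)] with ω h1 h2
      simp [IsGaussianRandomMeasure.toCLM, h1, h2]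
  rw [SimpleFunc.setToSimpleFunc]
  refine (Lp.coeFn_finsetSum _ _).trans ?_
  have h2 : ∀ᵐ ω ∂P, ∀ c ∈ φ.range,
      (hB.toCLM (φ ⁻¹' {c}) c : Lp ℝ 2 P) ω = c * B (φ ⁻¹' {c}) ω :=
    (Finset.eventually_all _).2 fun c _ => h1 c
  filter_upwards [h2] with ω hω
  simp only [Finset.sum_apply, simpleIntegral]
  exact Finset.sum_congr rfl hω

lemma memLp_simpleIntegral (hB : IsGaussianRandomMeasure B m P)
    {φ : SimpleFunc ℝ ℝ} (hφ : MemLp φ 2 m) : MemLp (simpleIntegral B φ) 2 P :=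
  (memLp_congr_ae (hB.coeFn_setToSimpleFunc hφ)).1 (Lp.memLp _)

lemma integrable_of_memLp_two {φ : SimpleFunc ℝ ℝ} (hφ : MemLp φ 2 m) : Integrable φ m :=
  (SimpleFunc.memLp_iff_integrable (by simp) (by simp)).1 hφ

lemma simpleIntegral_add (hB : IsGaussianRandomMeasure B m P)
    {φ ψ : SimpleFunc ℝ ℝ} (hφ : MemLp φ 2 m) (hψ : MemLp ψ 2 m) :
    simpleIntegral B (φ + ψ) =ᵐ[P] simpleIntegral B φ + simpleIntegral B ψ := by
  have h := SimpleFunc.setToSimpleFunc_add hB.toCLM hB.finMeasAdditive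
    (integrable_of_memLp_two hφ) (integrable_of_memLp_two hψ)
  have hs : MemLp (φ + ψ : SimpleFunc ℝ ℝ) 2 m := by
    rw [SimpleFunc.coe_add]; exact hφ.add hψ
  filter_upwards [hB.coeFn_setToSimpleFunc hφ, hB.coeFn_setToSimpleFunc hψ,
    hB.coeFn_setToSimpleFunc hs, Lp.coeFn_add (φ.setToSimpleFunc hB.toCLM)
      (ψ.setToSimpleFunc hB.toCLM)] with ω h1 h2 h3 h4
  rw [← h3, h, h4, Pi.add_apply, Pi.add_apply, h1, h2]

lemma simpleIntegral_smul (hB : IsGaussianRandomMeasure B m P) (c : ℝ)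
    {φ : SimpleFunc ℝ ℝ} (hφ : MemLp φ 2 m) :
    simpleIntegral B (c • φ) =ᵐ[P] c • simpleIntegral B φ := by
  have h := SimpleFunc.setToSimpleFunc_smul_real hB.toCLM hB.finMeasAdditive c
    (integrable_of_memLp_two hφ)
  have hs : MemLp (c • φ : SimpleFunc ℝ ℝ) 2 m := by
    rw [SimpleFunc.coe_smul]; exact hφ.const_smul c
  filter_upwards [hB.coeFn_setToSimpleFunc hφ,
    hB.coeFn_setToSimpleFunc hs, Lp.coeFn_smul c (φ.setToSimpleFunc hB.toCLM)] with ω h1 h3 h4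
  rw [← h3, h, h4, Pi.smul_apply, Pi.smul_apply, h1]

/-- The simple integral of `φ` is a centred Gaussian variable with variance `∫ φ² dm`. -/
lemma hasLaw_simpleIntegral [IsProbabilityMeasure P] (hB : IsGaussianRandomMeasure B m P)
    {φ : SimpleFunc ℝ ℝ} (hφ : MemLp φ 2 m) :
    HasLaw (simpleIntegral B φ) (gaussianReal 0 (∫⁻ x, ‖φ x‖ₑ ^ 2 ∂m).toNNReal) P := by
  classical
  have hfin : ∀ c : ℝ, c ≠ 0 → m (φ ⁻¹' {c}) < ⊤ := fun c hc =>
    SimpleFunc.measure_preimage_lt_top_of_memLp (by simp) (by simp) φ hφ c hc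
  set S := φ.range.erase 0 with hS
  let e := S.equivFin
  -- Independence is given for sequences of sets, so the finitely many nonzero fibres are enumerated
  -- and padded with `∅`.
  let A : ℕ → Set ℝ := fun i => if h : i < S.card then φ ⁻¹' {(e.symm ⟨i, h⟩ : ℝ)} else ∅
  have hAm : ∀ i, MeasurableSet (A i) := by
    intro i; simp only [A]; split_ifs
    · exact φ.measurableSet_fiber _
    · exact .empty
  have hAf : ∀ i, m (A i) < ⊤ := by
    intro i; simp only [A]; split_ifs with h
    · exact hfin _ (Finset.ne_of_mem_erase (e.symm ⟨i, h⟩).2)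
    · simp
  have hdisj : Pairwise (Function.onFun Disjoint A) := by
    intro i j hij
    simp only [Function.onFun, A]
    split_ifs with h h'
    · refine Set.disjoint_left.2 fun x hx hx' => hij ?_
      have : (e.symm ⟨i, h⟩ : ℝ) = e.symm ⟨j, h'⟩ := by
        rw [Set.mem_preimage, Set.mem_singleton_iff] at hx hx'; rw [← hx, hx']
      simpa using e.symm.injective (Subtype.ext this)
    · simp
    · simp
    · simp
  have hind : iIndepFun (fun c : S => B (φ ⁻¹' {(c : ℝ)})) P := by
    have := (hB.indep A hAm hAf hdisj).precomp
      (g := fun c : S => (e c : ℕ)) (fun c c' h => e.injective (Fin.ext h))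
    refine (iIndepFun_congr fun c => ?_).1 this
    have : A (e c) = φ ⁻¹' {(c : ℝ)} := by simp [A]
    simp [this]
  have hind2 : iIndepFun (fun (c : S) ω => (c : ℝ) * B (φ ⁻¹' {(c : ℝ)}) ω) P :=
    hind.comp (fun c x => (c : ℝ) * x) (by fun_prop)
  have hsum : simpleIntegral B φ = fun ω => ∑ c : S, (c : ℝ) * B (φ ⁻¹' {(c : ℝ)}) ω := by
    ext ω
    rw [Finset.sum_coe_sort S (fun c => c * B (φ ⁻¹' {c}) ω), simpleIntegral, hS,
      Finset.sum_erase]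
    simp
  have hlaw : ∀ c : S, HasLaw (B (φ ⁻¹' {(c : ℝ)})) (gaussianReal 0 (m (φ ⁻¹' {(c : ℝ)})).toNNReal) P :=
    fun c => hB.hasLaw _ (φ.measurableSet_fiber _) (hfin _ (Finset.ne_of_mem_erase c.2))
  have hmeas : AEMeasurable (simpleIntegral B φ) P := by
    rw [hsum]
    exact Finset.aemeasurable_fun_sum _ fun c _ => ((hlaw c).aemeasurable.const_mul _)
  refine ⟨hmeas, ?_⟩
  have : IsProbabilityMeasure (P.map (simpleIntegral B φ)) := Measure.isProbabilityMeasure_map hmeas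
  apply Measure.ext_of_charFun
  ext t
  have hvar : ((∫⁻ x, ‖φ x‖ₑ ^ 2 ∂m).toNNReal : ℝ) = ∑ c : S, (c : ℝ) ^ 2 * (m (φ ⁻¹' {(c : ℝ)})).toReal := by
    rw [Finset.sum_coe_sort S (fun c => c ^ 2 * (m (φ ⁻¹' {c})).toReal)]
    have h1 : ∫⁻ x, ‖φ x‖ₑ ^ 2 ∂m = ∑ c ∈ S, ‖c‖ₑ ^ 2 * m (φ ⁻¹' {c}) := by
      have := SimpleFunc.map_lintegral (μ := m) (fun c : ℝ => ‖c‖ₑ ^ 2) φ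
      rw [← SimpleFunc.lintegral_eq_lintegral] at this
      simp only [SimpleFunc.coe_map, Function.comp_def] at this
      rw [this, hS, Finset.sum_erase]
      simp
    rw [h1, ENNReal.coe_toNNReal_eq_toReal, ENNReal.toReal_sum]
    · refine Finset.sum_congr rfl fun c hc => ?_
      simp [ENNReal.toReal_mul]
    · intro c hc
      exact ENNReal.mul_ne_top (by simp) (hfin c (Finset.ne_of_mem_erase hc)).ne
  rw [hsum, hind2.charFun_map_fun_sum_eq_prod (fun c => (hlaw c).aemeasurable.const_mul _),
    Finset.prod_apply]
  simp_rw [charFun_map_mul_comp (hlaw _).aemeasurable, (hlaw _).map_eq, charFun_gaussianReal]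
  rw [← Complex.exp_sum, hvar]
  congr 1
  push_cast [ENNReal.coe_toNNReal_eq_toReal]
  simp only [mul_zero, zero_mul, zero_sub, Finset.sum_neg_distrib, Finset.sum_mul,
    Finset.sum_div]
  congr 1
  refine Finset.sum_congr rfl fun c _ => ?_
  ring

end WienerIntegral

lemma sq_eLpNorm_two {X : Type*} [MeasurableSpace X] {μ : Measure X} (f : X → ℝ) :
    eLpNorm f 2 μ ^ 2 = ∫⁻ x, ‖f x‖ₑ ^ 2 ∂μ := by
  have := eLpNorm_nnreal_pow_eq_lintegral (f := f) (μ := μ) (p := 2) (by norm_num)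
  rw [← ENNReal.rpow_natCast]
  refine Eq.trans this (lintegral_congr fun x => ?_)
  rw [← ENNReal.rpow_natCast]
  norm_num

lemma sq_eLpNorm_two_of_hasLaw {Ω : Type*} [MeasurableSpace Ω] {P : Measure Ω} {X : Ω → ℝ}
    {v : NNReal} (h : HasLaw X (gaussianReal 0 v) P) : eLpNorm X 2 P ^ 2 = v := by
  have h1 : eLpNorm X 2 P = eLpNorm id 2 (gaussianReal 0 v) := by
    rw [← h.map_eq, eLpNorm_map_measure aestronglyMeasurable_id h.aemeasurable]
    rfl
  have hmem : MemLp id 2 (gaussianReal 0 v) := memLp_id_gaussianReal' 2 (by simp)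
  have hvar : Var[id; gaussianReal 0 v] = v := variance_id_gaussianReal
  rw [variance_of_integral_eq_zero aemeasurable_id (by simp)] at hvar
  rw [h1, sq_eLpNorm_two]
  have h3 : ∀ x : ℝ, ‖id x‖ₑ ^ 2 = ENNReal.ofReal (x ^ 2) := by
    intro x
    rw [← sq_abs, ENNReal.ofReal_pow (abs_nonneg _), ← Real.norm_eq_abs, ofReal_norm]; rfl
  simp_rw [h3]
  have h4 := ofReal_integral_eq_lintegral_ofReal hmem.integrable_sq
    (ae_of_all _ fun x => sq_nonneg (id x))
  simp only [id] at hvar h4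
  rw [← h4, hvar, ENNReal.ofReal_coe_nnreal]

section WienerIntegral

variable {Ω : Type*} [MeasurableSpace Ω] {P : Measure Ω} {m : Measure ℝ} {B : Set ℝ → Ω → ℝ}

lemma eLpNorm_simpleIntegral [IsProbabilityMeasure P] (hB : IsGaussianRandomMeasure B m P)
    {φ : SimpleFunc ℝ ℝ} (hφ : MemLp φ 2 m) :
    eLpNorm (simpleIntegral B φ) 2 P = eLpNorm φ 2 m := by
  have h := sq_eLpNorm_two_of_hasLaw (hasLaw_simpleIntegral hB hφ)
  rw [ENNReal.coe_toNNReal, ← sq_eLpNorm_two] at h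
  · exact (ENNReal.pow_right_strictMono two_ne_zero).injective h
  · rw [← sq_eLpNorm_two]
    exact ENNReal.pow_ne_top hφ.2.ne

namespace IsWienerIntegral

lemma congr_ae {f : ℝ → ℝ} {Y Y' : Ω → ℝ} (h : IsWienerIntegral B m P f Y) (hY : Y =ᵐ[P] Y') :
    IsWienerIntegral B m P f Y' := by
  obtain ⟨h1, h2, φ, h3, h4, h5⟩ := h
  refine ⟨h1, (memLp_congr_ae hY).1 h2, φ, h3, h4, h5.congr fun i => eLpNorm_congr_ae ?_⟩
  filter_upwards [hY] with ω hω
  rw [hω]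

lemma zero : IsWienerIntegral B m P (fun _ => 0) (fun _ => 0) := by
  refine ⟨MemLp.zero', MemLp.zero', fun _ => 0, fun _ => ?_, ?_, ?_⟩
  · exact MemLp.zero'
  · simp
  · have : ∀ ω, simpleIntegral B 0 ω = 0 := by
      intro ω
      refine Finset.sum_eq_zero fun c hc => ?_
      obtain ⟨x, rfl⟩ := SimpleFunc.mem_range.1 hc
      simp
    simp [this]

lemma smul (hB : IsGaussianRandomMeasure B m P) {f : ℝ → ℝ} {Y : Ω → ℝ}
    (h : IsWienerIntegral B m P f Y) (c : ℝ) :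
    IsWienerIntegral B m P (fun y => c * f y) (fun ω => c * Y ω) := by
  obtain ⟨h1, h2, φ, h3, h4, h5⟩ := h
  refine ⟨h1.const_mul c, h2.const_mul c, fun i => c • φ i, fun i => ?_, ?_, ?_⟩
  · rw [SimpleFunc.coe_smul]; exact (h3 i).const_smul c
  · have := ENNReal.Tendsto.const_mul (a := ‖c‖ₑ) h4 (Or.inr (by simp))
    rw [mul_zero] at this
    refine this.congr fun i => ?_
    rw [← eLpNorm_const_smul]
    congr 1; ext y; simp [mul_sub]
  · have := ENNReal.Tendsto.const_mul (a := ‖c‖ₑ) h5 (Or.inr (by simp))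
    rw [mul_zero] at this
    refine this.congr fun i => ?_
    rw [← eLpNorm_const_smul]
    refine eLpNorm_congr_ae ?_
    filter_upwards [simpleIntegral_smul hB c (h3 i)] with ω hω
    rw [hω]; simp [mul_sub]

lemma add (hB : IsGaussianRandomMeasure B m P) {f g : ℝ → ℝ} {Y W : Ω → ℝ}
    (h : IsWienerIntegral B m P f Y) (h' : IsWienerIntegral B m P g W) :
    IsWienerIntegral B m P (fun y => f y + g y) (fun ω => Y ω + W ω) := by
  obtain ⟨h1, h2, φ, h3, h4, h5⟩ := h
  obtain ⟨k1, k2, ψ, k3, k4, k5⟩ := h'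
  refine ⟨h1.add k1, h2.add k2, fun i => φ i + ψ i, fun i => ?_, ?_, ?_⟩
  · rw [SimpleFunc.coe_add]; exact (h3 i).add (k3 i)
  · have := h4.add k4
    rw [add_zero] at this
    refine tendsto_of_tendsto_of_tendsto_of_le_of_le tendsto_const_nhds this
      (fun _ => zero_le) fun i => ?_
    refine le_trans (le_of_eq ?_) (eLpNorm_add_le ((h3 i).sub h1).1 ((k3 i).sub k1).1 (by norm_num))
    congr 1; ext y; simp; ring
  · have := h5.add k5
    rw [add_zero] at this
    refine tendsto_of_tendsto_of_tendsto_of_le_of_le tendsto_const_nhds this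
      (fun _ => zero_le) fun i => ?_
    refine le_trans (le_of_eq ?_) (eLpNorm_add_le ((memLp_simpleIntegral hB (h3 i)).sub h2).1
      ((memLp_simpleIntegral hB (k3 i)).sub k2).1 (by norm_num))
    refine eLpNorm_congr_ae ?_
    filter_upwards [simpleIntegral_add hB (h3 i) (k3 i)] with ω hω
    rw [hω]; simp; ring

lemma sum (hB : IsGaussianRandomMeasure B m P) {ι : Type*} (s : Finset ι) {f : ι → ℝ → ℝ}
    {Y : ι → Ω → ℝ} (h : ∀ i ∈ s, IsWienerIntegral B m P (f i) (Y i)) (c : ι → ℝ) :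
    IsWienerIntegral B m P (fun y => ∑ i ∈ s, c i * f i y) (fun ω => ∑ i ∈ s, c i * Y i ω) := by
  classical
  induction s using Finset.induction_on with
  | empty => simpa using zero
  | insert a s ha ih =>
    simp_rw [Finset.sum_insert ha]
    exact ((h a (by simp)).smul hB (c a)).add hB (ih fun i hi => h i (by simp [hi]))

lemma sub (hB : IsGaussianRandomMeasure B m P) {f g : ℝ → ℝ} {Y W : Ω → ℝ}
    (h : IsWienerIntegral B m P f Y) (h' : IsWienerIntegral B m P g W) :
    IsWienerIntegral B m P (fun y => f y - g y) (fun ω => Y ω - W ω) := by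
  simpa [sub_eq_add_neg] using h.add hB (h'.smul hB (-1))

variable [IsProbabilityMeasure P]

/-- The Wiener integral is isometric. -/
lemma eLpNorm_eq (hB : IsGaussianRandomMeasure B m P) {f : ℝ → ℝ} {Y : Ω → ℝ}
    (h : IsWienerIntegral B m P f Y) : eLpNorm Y 2 P = eLpNorm f 2 m := by
  obtain ⟨h1, h2, φ, h3, h4, h5⟩ := h
  have a1 := (Lp.tendsto_Lp_iff_tendsto_eLpNorm'' (fun i => ⇑(φ i)) h3 f h1).2 h4
  have a2 := (Lp.tendsto_Lp_iff_tendsto_eLpNorm'' (fun i => simpleIntegral B (φ i))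
    (fun i => memLp_simpleIntegral hB (h3 i)) Y h2).2 h5
  have b1 := a1.norm
  have b2 := a2.norm
  simp only [Lp.norm_toLp] at b1 b2
  simp_rw [eLpNorm_simpleIntegral hB (h3 _)] at b2
  exact (ENNReal.toReal_eq_toReal_iff' h2.2.ne h1.2.ne).1 (tendsto_nhds_unique b2 b1)

/-- Mean square convergence of the simple integrals implies convergence in law, and their Gaussian
characteristic functions converge because the `L²` norms of the integrands do. -/
lemma charFun_eq (hB : IsGaussianRandomMeasure B m P) {f : ℝ → ℝ} {Y : Ω → ℝ}
    (h : IsWienerIntegral B m P f Y) (t : ℝ) :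
    charFun (P.map Y) t = Complex.exp (-((eLpNorm f 2 m).toReal ^ 2 * t ^ 2 / 2 : ℝ)) := by
  obtain ⟨h1, h2, φ, h3, h4, h5⟩ := h
  have a1 := (Lp.tendsto_Lp_iff_tendsto_eLpNorm'' (fun i => ⇑(φ i)) h3 f h1).2 h4
  have b1 := a1.norm
  simp only [Lp.norm_toLp] at b1
  have hmeas : ∀ i, MemLp (simpleIntegral B (φ i)) 2 P := fun i => memLp_simpleIntegral hB (h3 i)
  have hm := tendstoInMeasure_of_tendsto_eLpNorm (p := 2) (by simp) (fun i => (hmeas i).1) h2.1 h5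
  have hd := (hm.tendstoInDistribution_of_aemeasurable (fun i => (hmeas i).1.aemeasurable)
    h2.1.aemeasurable).tendsto
  have hc := ProbabilityMeasure.tendsto_iff_tendsto_charFun.1 hd t
  simp only [ProbabilityMeasure.coe_mk] at hc
  refine tendsto_nhds_unique hc ?_
  have hcf : ∀ i, charFun (P.map (simpleIntegral B (φ i))) t
      = Complex.exp (-((eLpNorm (φ i) 2 m).toReal ^ 2 * t ^ 2 / 2 : ℝ)) := by
    intro i
    rw [(hasLaw_simpleIntegral hB (h3 i)).map_eq, charFun_gaussianReal, ← sq_eLpNorm_two,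
      ENNReal.coe_toNNReal_eq_toReal, ENNReal.toReal_pow]
    congr 1
    push_cast
    ring
  simp_rw [hcf]
  refine (Complex.continuous_exp.tendsto _).comp ?_
  refine Tendsto.neg ((Complex.continuous_ofReal.tendsto _).comp ?_)
  exact ((b1.pow 2).mul_const _).div_const _

end IsWienerIntegral

/-- Every square integrable function has a Wiener integral. -/
lemma exists_isWienerIntegral [IsProbabilityMeasure P] (hB : IsGaussianRandomMeasure B m P)
    {f : ℝ → ℝ} (hf : MemLp f 2 m) : ∃ Y : Ω → ℝ, IsWienerIntegral B m P f Y := by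
  have hex : ∀ i : ℕ, ∃ φ : SimpleFunc ℝ ℝ,
      eLpNorm (f - ⇑φ) 2 m < ((i : ENNReal) + 1)⁻¹ ∧ MemLp φ 2 m := fun i =>
    hf.exists_simpleFunc_eLpNorm_sub_lt (by simp) (by simp)
  choose φ hφ hφm using hex
  have h4 : Tendsto (fun i => eLpNorm (fun y => φ i y - f y) 2 m) atTop (𝓝 0) := by
    have hl : Tendsto (fun i : ℕ => ((i : ENNReal) + 1)⁻¹) atTop (𝓝 0) := by
      have := (tendsto_add_atTop_iff_nat 1).2 ENNReal.tendsto_inv_nat_nhds_zero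
      simpa using this
    refine tendsto_of_tendsto_of_tendsto_of_le_of_le tendsto_const_nhds hl
      (fun _ => zero_le) fun i => ?_
    have : (fun y => φ i y - f y) = (φ i : ℝ → ℝ) - f := rfl
    rw [this, eLpNorm_sub_comm]
    exact (hφ i).le
  have a1 := (Lp.tendsto_Lp_iff_tendsto_eLpNorm'' (fun i => ⇑(φ i)) hφm f hf).2 h4
  let I : ℕ → Lp ℝ 2 P := fun i => (memLp_simpleIntegral hB (hφm i)).toLp
  have hI : CauchySeq I := by
    -- The isometry on simple functions transfers the Cauchy property from the integrands to the
    -- integrals.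
    have hd : ∀ i j, dist (I i) (I j) = dist ((hφm i).toLp) ((hφm j).toLp) := by
      intro i j
      rw [dist_eq_norm, dist_eq_norm, ← MemLp.toLp_sub, ← MemLp.toLp_sub, Lp.norm_toLp,
        Lp.norm_toLp]
      congr 1
      have hm' : MemLp (φ i + (-1 : ℝ) • φ j : SimpleFunc ℝ ℝ) 2 m := by
        rw [SimpleFunc.coe_add, SimpleFunc.coe_smul]
        exact (hφm i).add ((hφm j).const_smul _)
      have hm'' : MemLp ((-1 : ℝ) • φ j : SimpleFunc ℝ ℝ) 2 m := by
        rw [SimpleFunc.coe_smul]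
        exact ((hφm j).const_smul _)
      have e1 : eLpNorm (φ i - φ j : ℝ → ℝ) 2 m
          = eLpNorm (φ i + (-1 : ℝ) • φ j : SimpleFunc ℝ ℝ) 2 m := by
        congr 1; ext y; simp [sub_eq_add_neg]
      rw [e1, ← eLpNorm_simpleIntegral hB hm']
      refine eLpNorm_congr_ae ?_
      filter_upwards [simpleIntegral_add hB (hφm i) hm'', simpleIntegral_smul hB (-1) (hφm j)]
        with ω h1 h2
      rw [h1, Pi.add_apply, h2]
      simp [sub_eq_add_neg]
    have := a1.cauchySeq
    rw [Metric.cauchySeq_iff] at this ⊢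
    simpa only [hd] using this
  obtain ⟨Y, hY⟩ := cauchySeq_tendsto_of_complete hI
  refine ⟨Y, hf, Lp.memLp Y, φ, hφm, h4, ?_⟩
  refine (Lp.tendsto_Lp_iff_tendsto_eLpNorm'' _ (fun i => memLp_simpleIntegral hB (hφm i)) Y
    (Lp.memLp Y)).1 ?_
  simpa [I] using hY

end WienerIntegral

/-! ### Weighted sums of i.i.d. variables -/

/-- Telescoping: the factors are exchanged one at a time, the others staying in the unit disc. -/
lemma norm_prod_sub_prod_le_sum {ι : Type*} (s : Finset ι) (a b : ι → ℂ)
    (ha : ∀ i ∈ s, ‖a i‖ ≤ 1) (hb : ∀ i ∈ s, ‖b i‖ ≤ 1) :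
    ‖∏ i ∈ s, a i - ∏ i ∈ s, b i‖ ≤ ∑ i ∈ s, ‖a i - b i‖ := by
  classical
  induction s using Finset.induction_on with
  | empty => simp
  | insert j s hj ih =>
    rw [Finset.prod_insert hj, Finset.prod_insert hj, Finset.sum_insert hj]
    have ih' := ih (fun i hi => ha i (by simp [hi])) (fun i hi => hb i (by simp [hi]))
    have h1 : ‖∏ i ∈ s, a i‖ ≤ 1 := by
      rw [norm_prod]
      exact Finset.prod_le_one (fun _ _ => norm_nonneg _) fun i hi => ha i (by simp [hi])
    have h2 := hb j (by simp)
    calc ‖a j * ∏ i ∈ s, a i - b j * ∏ i ∈ s, b i‖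
        = ‖(a j - b j) * ∏ i ∈ s, a i + b j * (∏ i ∈ s, a i - ∏ i ∈ s, b i)‖ := by
          congr 1; ring
      _ ≤ ‖a j - b j‖ * ‖∏ i ∈ s, a i‖ + ‖b j‖ * ‖∏ i ∈ s, a i - ∏ i ∈ s, b i‖ := by
          rw [← norm_mul, ← norm_mul]; exact norm_add_le _ _
      _ ≤ ‖a j - b j‖ * 1 + 1 * ∑ i ∈ s, ‖a i - b i‖ := by gcongr
      _ = _ := by ring

/-- Replaces unconditional convergence over finite sets by convergence along a sequence, as needed
by the limit theorems of measure theory. -/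
lemma tendsto_sum_of_hasSum {ι : Type*} {f : ι → ℝ} {a : ℝ} (h : HasSum f a) {S : ℕ → Finset ι}
    (hS : Tendsto S atTop atTop) : Tendsto (fun n => ∑ i ∈ S n, f i) atTop (𝓝 a) :=
  (show Tendsto (fun s : Finset ι => ∑ i ∈ s, f i) atTop (𝓝 a) by simpa [HasSum] using h).comp hS

section WeightedSum

variable {Ω : Type*} [MeasurableSpace Ω] {P : Measure Ω} [IsProbabilityMeasure P]

/-- A centred law with finite variance has, up to `o(u²)`, the characteristic function of the
Gaussian law with the same variance. -/
lemma charFun_sub_gaussian_isLittleO {X : Ω → ℝ} (hX : MemLp X 2 P) (hmean : ∫ ω, X ω ∂P = 0) :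
    (fun u : ℝ => charFun (P.map X) u - Complex.exp (-(Var[X; P] * u ^ 2 / 2 : ℝ)))
      =o[𝓝 0] fun u : ℝ => u ^ 2 := by
  have hmeas := hX.1.aemeasurable
  have hint : MemLp id 2 (P.map X) := (memLp_map_measure_iff aestronglyMeasurable_id hmeas).2 hX
  have : IsProbabilityMeasure (P.map X) := Measure.isProbabilityMeasure_map hmeas
  have hcd : ContDiff ℝ 2 (charFun (P.map X)) := contDiff_charFun (n := 2) hint
  -- Both functions have the second order Taylor polynomial `1 - Var u² / 2` at `0`.
  have h1 := taylor_isLittleO_univ (x₀ := 0) (n := 2) hcd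
  have hv : P[X ^ 2] = Var[X; P] := (variance_of_integral_eq_zero hmeas hmean).symm
  have hT : ∀ u : ℝ, taylorWithinEval (charFun (P.map X)) 2 Set.univ 0 u
      = 1 - (Var[X; P] * u ^ 2 / 2 : ℝ) := by
    intro u
    rw [taylorWithinEval_charFun_two_zero hmeas hint, hmean, hv]
    push_cast; ring
  simp only [hT, sub_zero] at h1
  have h2 : (fun u : ℝ => Complex.exp (-(Var[X; P] * u ^ 2 / 2 : ℝ))
      - (1 - (Var[X; P] * u ^ 2 / 2 : ℝ))) =o[𝓝 0] fun u : ℝ => u ^ 2 := by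
    have he : (fun z : ℂ => Complex.exp z - 1 - z) =o[𝓝 0] fun z => z := by
      have := (Complex.hasDerivAt_exp 0).isLittleO
      simpa using this
    have ht : Tendsto (fun u : ℝ => (-(Var[X; P] * u ^ 2 / 2 : ℝ) : ℂ)) (𝓝 0) (𝓝 0) := by
      have : Continuous (fun u : ℝ => (-(Var[X; P] * u ^ 2 / 2 : ℝ) : ℂ)) := by fun_prop
      simpa using this.tendsto 0
    refine ((he.comp_tendsto ht).congr_left fun u => ?_).trans_isBigO ?_
    · simp only [Function.comp]; push_cast; ring
    · refine Asymptotics.IsBigO.of_bound (Var[X; P] / 2) (Eventually.of_forall fun u => ?_)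
      simp only [Function.comp, norm_neg, Complex.norm_real, Real.norm_eq_abs, abs_div, abs_mul,
        abs_of_nonneg (variance_nonneg X P)]
      simp; ring_nf; rfl
  refine (h1.sub h2).congr_left fun u => ?_
  ring

variable {Z : ℤ → Ω → ℝ}

omit [IsProbabilityMeasure P] in
lemma charFun_finite_weighted_sum (hindep : iIndepFun Z P)
    (hident : ∀ j, IdentDistrib (Z j) (Z 0) P P) (w : ℤ → ℝ) (s : Finset ℤ) (t : ℝ) :
    charFun (P.map fun ω => ∑ i ∈ s, w i * Z i ω) t
      = ∏ i ∈ s, charFun (P.map (Z 0)) (w i * t) := by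
  have hm : ∀ i, AEMeasurable (Z i) P := fun i => (hident i).aemeasurable_fst
  have hind2 : iIndepFun (fun i ω => w i * Z i ω) P :=
    hindep.comp (fun i x => w i * x) (by fun_prop)
  rw [(hind2.restrict s).charFun_map_fun_finsetSum_eq_prod fun i _ => (hm i).const_mul _,
    Finset.prod_apply]
  refine Finset.prod_congr rfl fun i _ => ?_
  rw [charFun_map_mul_comp (hm i), (hident i).map_eq]

lemma ae_tendsto_charFun {W : Ω → ℝ} {X : ℕ → Ω → ℝ} (hX : ∀ n, AEMeasurable (X n) P)
    (h : ∀ᵐ ω ∂P, Tendsto (fun n => X n ω) atTop (𝓝 (W ω))) (t : ℝ) :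
    Tendsto (fun n => charFun (P.map (X n)) t) atTop (𝓝 (charFun (P.map W) t)) := by
  have hW : AEMeasurable W P := aemeasurable_of_tendsto_metrizable_ae' hX h
  exact ProbabilityMeasure.tendsto_iff_tendsto_charFun.1
    (tendstoInDistribution_of_ae_tendsto hX hW h).tendsto t

omit [IsProbabilityMeasure P] in
lemma aemeasurable_of_hasSum (hident : ∀ j, IdentDistrib (Z j) (Z 0) P P) {w : ℤ → ℝ} {W : Ω → ℝ}
    (hW : ∀ᵐ ω ∂P, HasSum (fun i => w i * Z i ω) (W ω)) : AEMeasurable W P := by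
  obtain ⟨S, hS⟩ := exists_seq_tendsto (atTop : Filter (Finset ℤ))
  refine aemeasurable_of_tendsto_metrizable_ae' (f := fun n ω => ∑ i ∈ S n, w i * Z i ω)
    (fun n => Finset.aemeasurable_fun_sum _ fun i _ => (hident i).aemeasurable_fst.const_mul _) ?_
  filter_upwards [hW] with ω hω
  exact tendsto_sum_of_hasSum hω hS

/-- Lindeberg's replacement argument in quantitative form: each factor is exchanged for a Gaussian
one at cost `ε (w i * t)²`. The bound is the same for every finite partial sum, so it survives the
passage to the series. -/
lemma norm_charFun_weighted_sum_sub_le (hindep : iIndepFun Z P)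
    (hident : ∀ j, IdentDistrib (Z j) (Z 0) P P) {w : ℤ → ℝ} {W : Ω → ℝ}
    (hw : Summable fun i => w i ^ 2)
    (hW : ∀ᵐ ω ∂P, HasSum (fun i => w i * Z i ω) (W ω)) (t : ℝ) {ε δ : ℝ} (hε : 0 ≤ ε)
    (hδ : ∀ u : ℝ, |u| ≤ δ →
      ‖charFun (P.map (Z 0)) u - Complex.exp (-(Var[Z 0; P] * u ^ 2 / 2 : ℝ))‖ ≤ ε * u ^ 2)
    (hwt : ∀ i, |w i * t| ≤ δ) :
    ‖charFun (P.map W) t - Complex.exp (-(Var[Z 0; P] * t ^ 2 * (∑' i, w i ^ 2) / 2 : ℝ))‖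
      ≤ ε * t ^ 2 * ∑' i, w i ^ 2 := by
  have hm0 : AEMeasurable (Z 0) P := (hident 0).aemeasurable_fst
  have : IsProbabilityMeasure (P.map (Z 0)) := Measure.isProbabilityMeasure_map hm0
  obtain ⟨S, hS⟩ := exists_seq_tendsto (atTop : Filter (Finset ℤ))
  have hfin : ∀ s : Finset ℤ, ‖charFun (P.map fun ω => ∑ i ∈ s, w i * Z i ω) t
      - Complex.exp (-(Var[Z 0; P] * t ^ 2 * (∑ i ∈ s, w i ^ 2) / 2 : ℝ))‖
        ≤ ε * t ^ 2 * ∑' i, w i ^ 2 := by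
    intro s
    have e1 : Complex.exp (-(Var[Z 0; P] * t ^ 2 * (∑ i ∈ s, w i ^ 2) / 2 : ℝ))
        = ∏ i ∈ s, Complex.exp (-(Var[Z 0; P] * (w i * t) ^ 2 / 2 : ℝ)) := by
      rw [← Complex.exp_sum]
      congr 1
      push_cast
      rw [Finset.sum_neg_distrib, Finset.mul_sum, Finset.sum_div]
      congr 1
      exact Finset.sum_congr rfl fun i _ => by ring
    rw [charFun_finite_weighted_sum hindep hident, e1]
    refine (norm_prod_sub_prod_le_sum s _ _ (fun i _ => norm_charFun_le_one _)
      fun i _ => ?_).trans ?_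
    · rw [← Complex.ofReal_neg, ← Complex.ofReal_exp, Complex.norm_real, Real.norm_eq_abs,
        abs_of_pos (Real.exp_pos _), Real.exp_le_one_iff]
      have := variance_nonneg (Z 0) P
      have : 0 ≤ Var[Z 0; P] * (w i * t) ^ 2 / 2 := by positivity
      linarith
    · refine (Finset.sum_le_sum fun i _ => hδ _ (hwt i)).trans ?_
      have : ∀ i ∈ s, ε * (w i * t) ^ 2 = ε * t ^ 2 * w i ^ 2 := fun i _ => by ring
      rw [Finset.sum_congr rfl this, ← Finset.mul_sum]
      exact mul_le_mul_of_nonneg_left (hw.sum_le_tsum s fun i _ => sq_nonneg _) (by positivity)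
  have hlim1 : Tendsto (fun n => charFun (P.map fun ω => ∑ i ∈ S n, w i * Z i ω) t) atTop
      (𝓝 (charFun (P.map W) t)) := by
    refine ae_tendsto_charFun (fun n => Finset.aemeasurable_fun_sum _ fun i _ =>
      (hident i).aemeasurable_fst.const_mul _) ?_ t
    filter_upwards [hW] with ω hω
    exact tendsto_sum_of_hasSum hω hS
  have hlim2 : Tendsto (fun n =>
      Complex.exp (-(Var[Z 0; P] * t ^ 2 * (∑ i ∈ S n, w i ^ 2) / 2 : ℝ))) atTop
      (𝓝 (Complex.exp (-(Var[Z 0; P] * t ^ 2 * (∑' i, w i ^ 2) / 2 : ℝ)))) := by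
    refine (Complex.continuous_exp.tendsto _).comp
      (Tendsto.neg ((Complex.continuous_ofReal.tendsto _).comp ?_))
    exact ((tendsto_sum_of_hasSum hw.hasSum hS).const_mul _).div_const _
  exact le_of_tendsto (hlim1.sub hlim2).norm (Eventually.of_forall fun n => hfin _)

/-- Central limit theorem for infinite weighted sums of i.i.d. variables with asymptotically
negligible weights. -/
lemma tendsto_charFun_weighted_sum (hindep : iIndepFun Z P)
    (hident : ∀ j, IdentDistrib (Z j) (Z 0) P P) (hmean : ∫ ω, Z 0 ω ∂P = 0)
    (hvar : MemLp (Z 0) 2 P) {w : ℕ → ℤ → ℝ} {W : ℕ → Ω → ℝ} {b : ℕ → ℝ} {v : ℝ}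
    (hw : ∀ᶠ n in atTop, Summable fun i => w n i ^ 2)
    (hW : ∀ᶠ n in atTop, ∀ᵐ ω ∂P, HasSum (fun i => w n i * Z i ω) (W n ω))
    (hb : ∀ᶠ n in atTop, ∀ i, |w n i| ≤ b n) (hb0 : Tendsto b atTop (𝓝 0))
    (hv : Tendsto (fun n => ∑' i, w n i ^ 2) atTop (𝓝 v)) (t : ℝ) :
    Tendsto (fun n => charFun (P.map (W n)) t) atTop
      (𝓝 (Complex.exp (-(Var[Z 0; P] * t ^ 2 * v / 2 : ℝ)))) := by
  have hG : Tendsto (fun n =>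
      Complex.exp (-(Var[Z 0; P] * t ^ 2 * (∑' i, w n i ^ 2) / 2 : ℝ))) atTop
      (𝓝 (Complex.exp (-(Var[Z 0; P] * t ^ 2 * v / 2 : ℝ)))) := by
    refine (Complex.continuous_exp.tendsto _).comp
      (Tendsto.neg ((Complex.continuous_ofReal.tendsto _).comp ?_))
    exact (hv.const_mul _).div_const _
  have hD : Tendsto (fun n => charFun (P.map (W n)) t -
      Complex.exp (-(Var[Z 0; P] * t ^ 2 * (∑' i, w n i ^ 2) / 2 : ℝ))) atTop (𝓝 0) := by
    rw [Metric.tendsto_nhds]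
    intro η hη
    have hv0 : 0 ≤ v := ge_of_tendsto' hv fun n => tsum_nonneg fun i => sq_nonneg _
    -- Eventually the squared weights sum to less than `v + 1`, so the total error is below `η`; the
    -- last `+ 1` keeps the denominator positive when `t = 0`.
    set ε := η / (t ^ 2 * (v + 1) + 1) with hεdef
    have hden : 0 < t ^ 2 * (v + 1) + 1 := by positivity
    have hε : 0 < ε := div_pos hη hden
    have hlo := (charFun_sub_gaussian_isLittleO hvar hmean).def hε
    obtain ⟨δ, hδ0, hδ⟩ := Metric.eventually_nhds_iff.1 hlo
    have hbt : Tendsto (fun n => b n * |t|) atTop (𝓝 0) := by simpa using hb0.mul_const |t|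
    filter_upwards [hw, hW, hb, hbt.eventually_lt_const (half_pos hδ0),
      hv.eventually_lt_const (lt_add_one v)] with n h1 h2 h3 h4 h5
    rw [dist_zero_right]
    have := norm_charFun_weighted_sum_sub_le hindep hident h1 h2 t (ε := ε) (δ := δ / 2) hε.le ?_ ?_
    · refine this.trans_lt ?_
      calc ε * t ^ 2 * ∑' i, w n i ^ 2 ≤ ε * t ^ 2 * (v + 1) := by gcongr
        _ < ε * (t ^ 2 * (v + 1) + 1) := by nlinarith
        _ = η := by rw [hεdef]; field_simp
    · intro u hu
      have hu' : dist u 0 < δ := by rw [dist_zero_right, Real.norm_eq_abs]; linarith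
      simpa using hδ hu'
    · intro i
      rw [abs_mul]
      exact (mul_le_mul_of_nonneg_right (h3 i) (abs_nonneg t)).trans h4.le
  simpa using hD.add hG

/-- The second moment of an infinite weighted sum of i.i.d. centred variables. -/
lemma sq_eLpNorm_weighted_sum_le (hindep : iIndepFun Z P)
    (hident : ∀ j, IdentDistrib (Z j) (Z 0) P P) (hmean : ∫ ω, Z 0 ω ∂P = 0)
    (hvar : MemLp (Z 0) 2 P) {w : ℤ → ℝ} {W : Ω → ℝ} (hw : Summable fun i => w i ^ 2)
    (hW : ∀ᵐ ω ∂P, HasSum (fun i => w i * Z i ω) (W ω)) :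
    eLpNorm W 2 P ^ 2 ≤ ENNReal.ofReal (Var[Z 0; P] * ∑' i, w i ^ 2) := by
  have hm : ∀ i, MemLp (Z i) 2 P := fun i => (hident i).memLp_iff.2 hvar
  have hmean' : ∀ i, ∫ ω, Z i ω ∂P = 0 := fun i => (hident i).integral_eq.trans hmean
  obtain ⟨S, hS⟩ := exists_seq_tendsto (atTop : Filter (Finset ℤ))
  have hfin : ∀ s : Finset ℤ, eLpNorm (fun ω => ∑ i ∈ s, w i * Z i ω) 2 P ^ 2
      ≤ ENNReal.ofReal (Var[Z 0; P] * ∑' i, w i ^ 2) := by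
    intro s
    have hmi : ∀ i ∈ s, MemLp (fun ω => w i * Z i ω) 2 P := fun i _ => (hm i).const_mul _
    have hms : MemLp (∑ i ∈ s, fun ω => w i * Z i ω) 2 P := memLp_finsetSum' s hmi
    have hind2 : iIndepFun (fun i ω => w i * Z i ω) P :=
      hindep.comp (fun i x => w i * x) (by fun_prop)
    have hv := IndepFun.variance_sum hmi fun i _ j _ hij => hind2.indepFun hij
    have hfun : (fun ω => ∑ i ∈ s, w i * Z i ω) = ∑ i ∈ s, fun ω => w i * Z i ω := by
      ext ω; simp
    have hz : ∫ ω, (∑ i ∈ s, fun ω => w i * Z i ω) ω ∂P = 0 := by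
      rw [← hfun, integral_finsetSum _ fun i hi => (hmi i hi).integrable (by norm_num)]
      exact Finset.sum_eq_zero fun i _ => by rw [integral_const_mul, hmean' i, mul_zero]
    rw [variance_of_integral_eq_zero hms.1.aemeasurable hz] at hv
    rw [hfun, sq_eLpNorm_two]
    have h3 : ∀ ω, ‖(∑ i ∈ s, fun ω => w i * Z i ω) ω‖ₑ ^ 2
        = ENNReal.ofReal ((∑ i ∈ s, fun ω => w i * Z i ω) ω ^ 2) := by
      intro ω
      rw [← sq_abs, ENNReal.ofReal_pow (abs_nonneg _), ← Real.norm_eq_abs, ofReal_norm]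
    simp_rw [h3]
    rw [← ofReal_integral_eq_lintegral_ofReal hms.integrable_sq (ae_of_all _ fun x => sq_nonneg _)]
    refine ENNReal.ofReal_le_ofReal (hv.le.trans ?_)
    have h4 : ∀ i ∈ s, Var[fun ω => w i * Z i ω; P] = Var[Z 0; P] * w i ^ 2 := fun i _ => by
      rw [variance_const_mul, (hident i).variance_eq, mul_comm]
    rw [Finset.sum_congr rfl h4, ← Finset.mul_sum]
    exact mul_le_mul_of_nonneg_left (hw.sum_le_tsum s fun i _ => sq_nonneg _)
      (variance_nonneg _ _)
  -- Fatou gives only an upper bound for the series, which is all that the increment estimates need.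
  have hlim := Lp.eLpNorm_lim_le_liminf_eLpNorm (p := 2)
    (f := fun n ω => ∑ i ∈ S n, w i * Z i ω)
    (fun n => (memLp_finsetSum (S n) fun i _ => (hm i).const_mul (w i)).1) W
    (by filter_upwards [hW] with ω hω using tendsto_sum_of_hasSum hω hS)
  have hsq : ∀ n, eLpNorm (fun ω => ∑ i ∈ S n, w i * Z i ω) 2 P
      ≤ (ENNReal.ofReal (Var[Z 0; P] * ∑' i, w i ^ 2)) ^ (2 : ℝ)⁻¹ := by
    intro n
    rw [ENNReal.le_rpow_inv_iff (by norm_num)]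
    simpa using hfin (S n)
  have hle : eLpNorm W 2 P ≤ (ENNReal.ofReal (Var[Z 0; P] * ∑' i, w i ^ 2)) ^ (2 : ℝ)⁻¹ :=
    hlim.trans ((liminf_le_liminf (Eventually.of_forall hsq)).trans (by simp))
  rw [ENNReal.le_rpow_inv_iff (by norm_num)] at hle
  simpa using hle

/-- A series of identically distributed integrable variables with summable weights converges
absolutely almost surely. -/
lemma ae_summable_weighted (hident : ∀ j, IdentDistrib (Z j) (Z 0) P P)
    (hvar : MemLp (Z 0) 2 P) {ι : Type*} [Countable ι] (w : ι → ℝ) (k : ι → ℤ)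
    (hw : Summable fun i => |w i|) : ∀ᵐ ω ∂P, Summable fun i => |w i * Z (k i) ω| := by
  have hm : ∀ i, AEMeasurable (Z i) P := fun i => (hident i).aemeasurable_fst
  have hI : ∀ i, ∫⁻ ω, ‖Z i ω‖ₑ ∂P = ∫⁻ ω, ‖Z 0 ω‖ₑ ∂P := fun i =>
    ((hident i).comp (u := fun x : ℝ => ‖x‖ₑ) measurable_enorm).lintegral_eq
  have hfin : ∫⁻ ω, ‖Z 0 ω‖ₑ ∂P < ⊤ := (hvar.integrable (by norm_num)).2
  -- By Tonelli the mean of the sum of absolute values is `(∑ |w i|) E|Z 0|`.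
  have hsum : ∫⁻ ω, ∑' i, ‖w i * Z (k i) ω‖ₑ ∂P ≠ ⊤ := by
    rw [lintegral_tsum fun i => ((hm _).const_mul _).enorm]
    have : ∀ i, ∫⁻ ω, ‖w i * Z (k i) ω‖ₑ ∂P = ENNReal.ofReal |w i| * ∫⁻ ω, ‖Z 0 ω‖ₑ ∂P := by
      intro i
      simp_rw [enorm_mul]
      rw [lintegral_const_mul'' _ (hm _).enorm, hI, ← Real.norm_eq_abs, ofReal_norm]
    simp_rw [this]
    rw [ENNReal.tsum_mul_right]
    exact ENNReal.mul_ne_top (hw.tsum_ofReal_ne_top) hfin.ne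
  have hae := ae_lt_top' (AEMeasurable.tsum fun i => ((hm (k i)).const_mul (w i)).enorm) hsum
  filter_upwards [hae] with ω hω
  have := ENNReal.summable_toReal hω.ne
  simpa using this

end WeightedSum

/-! ### Dyadic interpolation in `C[0,1]` -/

/-- The hat function of level `m` centred at `k / 2^m`. -/
def hat (m k : ℕ) : C(unitInterval, ℝ) where
  toFun t := max 0 (1 - |2 ^ m * (t : ℝ) - k|)
  continuous_toFun := by fun_prop

/-- The polygonal function of level `m` with value `v k` at `k / 2^m`. -/
def interp (m : ℕ) (v : ℕ → ℝ) : C(unitInterval, ℝ) :=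
  ∑ k ∈ Finset.range (2 ^ m + 2), v k • hat m k

/-- The dyadic point `k / 2^m`, truncated to the unit interval. -/
def node (m k : ℕ) : unitInterval := Set.projIcc 0 1 zero_le_one ((k : ℝ) / 2 ^ m)

lemma floor_le_two_pow (m : ℕ) (t : unitInterval) : ⌊(2 : ℝ) ^ m * t⌋₊ ≤ 2 ^ m := by
  have : (2 : ℝ) ^ m * t ≤ (2 ^ m : ℕ) := by
    push_cast; exact mul_le_of_le_one_right (by positivity) t.2.2
  exact Nat.floor_le_of_le this

/-- Only the two hats next to `t` are nonzero there. At `t = 1` the left index is `2^m` and its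
successor `2^m + 1`, which is why `interp` uses `2^m + 2` hats. -/
lemma interp_apply (m : ℕ) (v : ℕ → ℝ) (t : unitInterval) :
    interp m v t = (1 - (2 ^ m * (t : ℝ) - ⌊(2 : ℝ) ^ m * t⌋₊)) * v ⌊(2 : ℝ) ^ m * t⌋₊
      + (2 ^ m * (t : ℝ) - ⌊(2 : ℝ) ^ m * t⌋₊) * v (⌊(2 : ℝ) ^ m * t⌋₊ + 1) := by
  set k := ⌊(2 : ℝ) ^ m * t⌋₊ with hk
  have ht0 : (0 : ℝ) ≤ 2 ^ m * t := mul_nonneg (by positivity) t.2.1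
  have h1 : (k : ℝ) ≤ 2 ^ m * t := Nat.floor_le ht0
  have h2 : 2 ^ m * (t : ℝ) < k + 1 := Nat.lt_floor_add_one _
  have hkle : k ≤ 2 ^ m := floor_le_two_pow m t
  have hsum : interp m v t = ∑ j ∈ Finset.range (2 ^ m + 2), v j * hat m j t := by
    simp [interp, ContinuousMap.sum_apply]
  have hsub : ({k, k + 1} : Finset ℕ) ⊆ Finset.range (2 ^ m + 2) := by
    intro j hj
    simp only [Finset.mem_insert, Finset.mem_singleton] at hj
    rw [Finset.mem_range]; omega
  rw [hsum, ← Finset.sum_subset hsub, Finset.sum_pair (by omega)]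
  · have e1 : hat m k t = 1 - (2 ^ m * (t : ℝ) - k) := by
      simp only [hat, ContinuousMap.coe_mk]
      rw [abs_of_nonneg (by linarith), max_eq_right (by linarith)]
    have e2 : hat m (k + 1) t = 2 ^ m * (t : ℝ) - k := by
      simp only [hat, ContinuousMap.coe_mk]
      push_cast
      rw [abs_of_nonpos (by linarith), max_eq_right (by linarith)]
      ring
    rw [e1, e2]; ring
  · intro j _ hj
    simp only [Finset.mem_insert, Finset.mem_singleton, not_or] at hj
    have : hat m j t = 0 := by
      simp only [hat, ContinuousMap.coe_mk]
      refine max_eq_left ?_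
      rcases lt_or_gt_of_ne hj.1 with h | h
      · have : (j : ℝ) + 1 ≤ k := by exact_mod_cast h
        have := le_abs_self (2 ^ m * (t : ℝ) - j)
        linarith
      · have h' : k + 2 ≤ j := by omega
        have : (k : ℝ) + 2 ≤ j := by exact_mod_cast h'
        have := neg_abs_le (2 ^ m * (t : ℝ) - j)
        linarith
    rw [this, mul_zero]

lemma interp_apply_eq_convex (m : ℕ) (v : ℕ → ℝ) (t : unitInterval) :
    ∃ θ : ℝ, 0 ≤ θ ∧ θ ≤ 1 ∧ interp m v t
      = (1 - θ) * v ⌊(2 : ℝ) ^ m * t⌋₊ + θ * v (⌊(2 : ℝ) ^ m * t⌋₊ + 1) := by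
  have ht0 : (0 : ℝ) ≤ 2 ^ m * t := mul_nonneg (by positivity) t.2.1
  refine ⟨_, ?_, ?_, interp_apply m v t⟩
  · exact sub_nonneg.2 (Nat.floor_le ht0)
  · have := Nat.lt_floor_add_one ((2 : ℝ) ^ m * t)
    linarith

/-- Projection onto the unit interval is 1-Lipschitz and fixes `t`, so truncating the node beyond
`1` costs nothing. -/
lemma dist_node_le (m k : ℕ) (t : unitInterval) {d : ℝ} (h : |(k : ℝ) - 2 ^ m * t| ≤ d) :
    |(node m k : ℝ) - t| ≤ d / 2 ^ m := by
  have h1 : t = Set.projIcc 0 1 zero_le_one (t : ℝ) := (Set.projIcc_val _ t).symm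
  have h2 : |(node m k : ℝ) - t| ≤ |(k : ℝ) / 2 ^ m - t| := by
    conv_lhs => rw [h1]
    exact Set.abs_projIcc_sub_projIcc zero_le_one
  refine h2.trans ?_
  have h3 : (k : ℝ) / 2 ^ m - t = (k - 2 ^ m * t) / 2 ^ m := by field_simp
  rw [h3, abs_div, abs_of_pos (by positivity : (0 : ℝ) < 2 ^ m)]
  gcongr

lemma dist_node_floor_le (m : ℕ) (t : unitInterval) :
    |(node m ⌊(2 : ℝ) ^ m * t⌋₊ : ℝ) - t| ≤ 1 / 2 ^ m := by
  have ht0 : (0 : ℝ) ≤ 2 ^ m * t := mul_nonneg (by positivity) t.2.1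
  refine dist_node_le m _ t ?_
  have h1 := Nat.floor_le ht0
  have h2 := Nat.lt_floor_add_one ((2 : ℝ) ^ m * t)
  rw [abs_le]; constructor <;> linarith

lemma dist_node_floor_add_one_le (m : ℕ) (t : unitInterval) :
    |(node m (⌊(2 : ℝ) ^ m * t⌋₊ + 1) : ℝ) - t| ≤ 1 / 2 ^ m := by
  have ht0 : (0 : ℝ) ≤ 2 ^ m * t := mul_nonneg (by positivity) t.2.1
  refine dist_node_le m _ t ?_
  have h1 := Nat.floor_le ht0
  have h2 := Nat.lt_floor_add_one ((2 : ℝ) ^ m * t)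
  push_cast
  rw [abs_le]; constructor <;> linarith

lemma dist_node_succ_le (m k : ℕ) : |(node m (k + 1) : ℝ) - node m k| ≤ 1 / 2 ^ m := by
  refine (Set.abs_projIcc_sub_projIcc zero_le_one).trans ?_
  push_cast
  rw [← sub_div, add_sub_cancel_left, abs_of_pos (by positivity)]

lemma node_succ_two_mul (m k : ℕ) : node (m + 1) (2 * k) = node m k := by
  unfold node
  congr 1
  push_cast
  rw [pow_succ]
  field_simp

lemma tendsto_interp (x : C(unitInterval, ℝ)) :
    Tendsto (fun m => interp m fun k => x (node m k)) atTop (𝓝 x) := by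
  rw [Metric.tendsto_atTop]
  intro ε hε
  have hu : UniformContinuous x := CompactSpace.uniformContinuous_of_continuous x.continuous
  obtain ⟨δ, hδ, h⟩ := Metric.uniformContinuous_iff.1 hu (ε / 2) (half_pos hε)
  have hl : Tendsto (fun m : ℕ => 1 / (2 : ℝ) ^ m) atTop (𝓝 0) := by
    have := tendsto_pow_atTop_nhds_zero_of_lt_one (r := (1 / 2 : ℝ)) (by norm_num) (by norm_num)
    simpa using this
  obtain ⟨N, hN⟩ := eventually_atTop.1 (hl.eventually_lt_const hδ)
  refine ⟨N, fun m hm => ?_⟩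
  refine lt_of_le_of_lt ((ContinuousMap.dist_le (half_pos hε).le).2 fun t => ?_) (half_lt_self hε)
  obtain ⟨θ, h0, h1, he⟩ := interp_apply_eq_convex m (fun k => x (node m k)) t
  rw [he, Real.dist_eq]
  have a1 := (h (a := node m ⌊(2 : ℝ) ^ m * t⌋₊) (b := t)
    (by rw [Subtype.dist_eq, Real.dist_eq]; exact (dist_node_floor_le m t).trans_lt (hN m hm))).le
  have a2 := (h (a := node m (⌊(2 : ℝ) ^ m * t⌋₊ + 1)) (b := t)
    (by rw [Subtype.dist_eq, Real.dist_eq]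
        exact (dist_node_floor_add_one_le m t).trans_lt (hN m hm))).le
  rw [Real.dist_eq, abs_le] at a1 a2
  rw [abs_le]
  constructor <;> nlinarith

/-- The sum of the squared increments over the dyadic intervals of level `m`. -/
def incSq (m : ℕ) (x : unitInterval → ℝ) : ℝ :=
  ∑ k ∈ Finset.range (2 ^ m + 1), (x (node m (k + 1)) - x (node m k)) ^ 2

lemma incSq_nonneg (m : ℕ) (x : unitInterval → ℝ) : 0 ≤ incSq m x :=
  Finset.sum_nonneg fun _ _ => sq_nonneg _

/-- Lets a maximum of increments be controlled by a sum of squares that enters linearly, hence can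
be integrated; the free parameter `r` is balanced later. -/
lemma abs_le_add_inv_mul_sq {r : ℝ} (hr : 0 < r) (a : ℝ) : |a| ≤ r + r⁻¹ * a ^ 2 := by
  rw [← sq_abs a]
  have h : 0 ≤ r⁻¹ * ((|a| - r) ^ 2 + r * |a|) := by positivity
  have h2 : r⁻¹ * ((|a| - r) ^ 2 + r * |a|) = r⁻¹ * |a| ^ 2 - |a| + r := by
    field_simp; ring
  linarith

lemma abs_inc_le {r : ℝ} (hr : 0 < r) (m : ℕ) (x : unitInterval → ℝ) {k : ℕ} (hk : k ≤ 2 ^ m) :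
    |x (node m (k + 1)) - x (node m k)| ≤ r + r⁻¹ * incSq m x := by
  refine (abs_le_add_inv_mul_sq hr _).trans ?_
  gcongr
  exact Finset.single_le_sum (f := fun k => (x (node m (k + 1)) - x (node m k)) ^ 2)
    (fun _ _ => sq_nonneg _) (Finset.mem_range.2 (by omega))

lemma abs_interp_sub_node_le {R : ℝ} (m : ℕ) (x : unitInterval → ℝ)
    (hR : ∀ k ≤ 2 ^ m, |x (node m (k + 1)) - x (node m k)| ≤ R) (t : unitInterval) :
    |interp m (fun k => x (node m k)) t - x (node m ⌊(2 : ℝ) ^ m * t⌋₊)| ≤ R := by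
  obtain ⟨θ, h0, h1, he⟩ := interp_apply_eq_convex m (fun k => x (node m k)) t
  rw [he]
  have := hR _ (floor_le_two_pow m t)
  set a := x (node m (⌊(2 : ℝ) ^ m * t⌋₊ + 1)) - x (node m ⌊(2 : ℝ) ^ m * t⌋₊) with ha
  have e : (1 - θ) * x (node m ⌊(2 : ℝ) ^ m * t⌋₊) + θ * x (node m (⌊(2 : ℝ) ^ m * t⌋₊ + 1))
      - x (node m ⌊(2 : ℝ) ^ m * t⌋₊) = θ * a := by rw [ha]; ring
  rw [e, abs_mul, abs_of_nonneg h0]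
  exact (mul_le_of_le_one_left (abs_nonneg _) h1).trans this

/-- Each interpolant is compared with its value at the node to the left of `t`. The left index on
the finer grid is `2k` or `2k + 1`, so the two left nodes coincide or are fine neighbours. -/
lemma dist_interp_succ_le {R R' : ℝ} (m : ℕ) (x : unitInterval → ℝ)
    (hR : ∀ k ≤ 2 ^ m, |x (node m (k + 1)) - x (node m k)| ≤ R)
    (hR' : ∀ k ≤ 2 ^ (m + 1), |x (node (m + 1) (k + 1)) - x (node (m + 1) k)| ≤ R') :
    dist (interp m fun k => x (node m k)) (interp (m + 1) fun k => x (node (m + 1) k))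
      ≤ R + 2 * R' := by
  have hR0 : 0 ≤ R := (abs_nonneg _).trans (hR 0 (by simp))
  have hR0' : 0 ≤ R' := (abs_nonneg _).trans (hR' 0 (by simp))
  refine (ContinuousMap.dist_le (by positivity)).2 fun t => ?_
  have h1 := abs_interp_sub_node_le m x hR t
  have h2 := abs_interp_sub_node_le (m + 1) x hR' t
  have h3 : |x (node (m + 1) ⌊(2 : ℝ) ^ (m + 1) * t⌋₊) - x (node m ⌊(2 : ℝ) ^ m * t⌋₊)| ≤ R' := by
    have ht0 : (0 : ℝ) ≤ 2 ^ m * t := mul_nonneg (by positivity) t.2.1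
    set k := ⌊(2 : ℝ) ^ m * t⌋₊ with hk
    have a1 : (k : ℝ) ≤ 2 ^ m * t := Nat.floor_le ht0
    have a2 : 2 ^ m * (t : ℝ) < k + 1 := Nat.lt_floor_add_one _
    have hkle : k ≤ 2 ^ m := floor_le_two_pow m t
    rw [← node_succ_two_mul m k]
    have b1 : 2 * k ≤ ⌊(2 : ℝ) ^ (m + 1) * t⌋₊ := by
      apply Nat.le_floor
      push_cast; rw [pow_succ]; nlinarith
    have b2 : ⌊(2 : ℝ) ^ (m + 1) * t⌋₊ < 2 * k + 2 := by
      rw [Nat.floor_lt (mul_nonneg (by positivity) t.2.1)]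
      · push_cast; rw [pow_succ]; nlinarith
    have hc : ⌊(2 : ℝ) ^ (m + 1) * t⌋₊ = 2 * k ∨ ⌊(2 : ℝ) ^ (m + 1) * t⌋₊ = 2 * k + 1 := by omega
    rcases hc with hc | hc
    · rw [hc]; simpa using hR0'
    · rw [hc]; exact hR' _ (by rw [pow_succ]; omega)
  rw [Real.dist_eq]
  rw [abs_le] at h1 h2 h3 ⊢
  constructor <;> linarith

/-! ### Chaining over dyadic levels with second moments -/

section Moments

variable {Ω : Type*} [MeasurableSpace Ω] {P : Measure Ω}

/-- There are about `2^m` increments, each of mean square at most `C 2^(-m(1+κ))`; the excess `κ` in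
the exponent is the gain. -/
lemma lintegral_incSq_le {X : unitInterval → Ω → ℝ} (hX : ∀ t, AEMeasurable (X t) P)
    {C κ : ℝ} (hC : 0 ≤ C) (hκ : 0 < κ)
    (hmom : ∀ s t, ∫⁻ ω, ENNReal.ofReal ((X t ω - X s ω) ^ 2) ∂P
      ≤ ENNReal.ofReal (C * |(t : ℝ) - s| ^ (1 + κ))) (m : ℕ) :
    ∫⁻ ω, ENNReal.ofReal (incSq m fun t => X t ω) ∂P
      ≤ ENNReal.ofReal (2 * C * ((2 : ℝ) ^ (-κ)) ^ m) := by
  unfold incSq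
  have h1 : ∀ ω, ENNReal.ofReal (∑ k ∈ Finset.range (2 ^ m + 1),
      (X (node m (k + 1)) ω - X (node m k) ω) ^ 2) = ∑ k ∈ Finset.range (2 ^ m + 1),
      ENNReal.ofReal ((X (node m (k + 1)) ω - X (node m k) ω) ^ 2) := fun ω =>
    ENNReal.ofReal_sum_of_nonneg fun _ _ => sq_nonneg _
  simp_rw [h1]
  have hd : ∀ s t, AEMeasurable (fun ω => X t ω - X s ω) P := fun s t => (hX t).sub (hX s)
  rw [lintegral_finsetSum' _ fun k _ => ((hd _ _).pow_const 2).ennreal_ofReal]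
  have h2 : ∀ k ∈ Finset.range (2 ^ m + 1),
      ∫⁻ ω, ENNReal.ofReal ((X (node m (k + 1)) ω - X (node m k) ω) ^ 2) ∂P
        ≤ ENNReal.ofReal (C * (1 / 2 ^ m) ^ (1 + κ)) := by
    intro k _
    refine (hmom _ _).trans (ENNReal.ofReal_le_ofReal ?_)
    gcongr
    exact dist_node_succ_le m k
  refine (Finset.sum_le_sum h2).trans ?_
  rw [Finset.sum_const, Finset.card_range, nsmul_eq_mul, ← ENNReal.ofReal_natCast,
    ← ENNReal.ofReal_mul (by positivity)]
  refine ENNReal.ofReal_le_ofReal ?_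
  have e1 : ((1 : ℝ) / 2 ^ m) ^ (1 + κ) = 1 / 2 ^ m * ((2 : ℝ) ^ (-κ)) ^ m := by
    rw [Real.rpow_add (by positivity), Real.rpow_one, one_div, Real.inv_rpow (by positivity),
      ← Real.rpow_natCast 2 m, ← Real.rpow_mul (by norm_num), mul_comm (m : ℝ) κ,
      Real.rpow_mul (by norm_num), Real.rpow_natCast, Real.rpow_neg (by norm_num), inv_pow,
      Real.rpow_natCast]
  rw [e1]
  have h3 : (1 : ℝ) ≤ 2 ^ m := one_le_pow₀ (by norm_num)
  have h4 : ((2 ^ m + 1 : ℕ) : ℝ) * (1 / 2 ^ m) ≤ 2 := by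
    push_cast
    rw [mul_one_div, div_le_iff₀ (by positivity)]
    linarith
  calc ((2 ^ m + 1 : ℕ) : ℝ) * (C * (1 / 2 ^ m * ((2 : ℝ) ^ (-κ)) ^ m))
      = (((2 ^ m + 1 : ℕ) : ℝ) * (1 / 2 ^ m)) * (C * ((2 : ℝ) ^ (-κ)) ^ m) := by ring
    _ ≤ 2 * (C * ((2 : ℝ) ^ (-κ)) ^ m) := by gcongr
    _ = _ := by ring

/-- The mean distance between successive dyadic interpolations decays geometrically. -/
lemma lintegral_edist_interp_succ_le [IsProbabilityMeasure P] {X : unitInterval → Ω → ℝ}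
    (hX : ∀ t, AEMeasurable (X t) P) {C κ : ℝ} (hC : 0 ≤ C) (hκ : 0 < κ)
    (hmom : ∀ s t, ∫⁻ ω, ENNReal.ofReal ((X t ω - X s ω) ^ 2) ∂P
      ≤ ENNReal.ofReal (C * |(t : ℝ) - s| ^ (1 + κ))) (m : ℕ) :
    ∫⁻ ω, edist (interp m fun k => X (node m k) ω)
        (interp (m + 1) fun k => X (node (m + 1) k) ω) ∂P
      ≤ ENNReal.ofReal (3 * (1 + 2 * C)) * ENNReal.ofReal ((2 : ℝ) ^ (-κ / 2)) ^ m := by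
  -- The mean of `incSq j` is at most `2 C ρ^(2j)`, so the choice `r = ρ^j` makes both terms of `r +
  -- r⁻¹ * incSq` of order `ρ^j`.
  set ρ : ℝ := (2 : ℝ) ^ (-κ / 2) with hρ
  have hρ0 : 0 < ρ := by positivity
  have hρ1 : ρ ≤ 1 := Real.rpow_le_one_of_one_le_of_nonpos (by norm_num) (by linarith)
  have hρ2 : (2 : ℝ) ^ (-κ) = ρ ^ 2 := by
    rw [hρ, ← Real.rpow_natCast, ← Real.rpow_mul (by norm_num)]; congr 1; push_cast; ring
  have hRm : ∀ j : ℕ, ∫⁻ ω, ENNReal.ofReal (ρ ^ j + (ρ ^ j)⁻¹ * incSq j fun t => X t ω) ∂P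
      ≤ ENNReal.ofReal ((1 + 2 * C) * ρ ^ j) := by
    intro j
    have hp : 0 < ρ ^ j := by positivity
    have e : ∀ ω, ENNReal.ofReal (ρ ^ j + (ρ ^ j)⁻¹ * incSq j fun t => X t ω)
        = ENNReal.ofReal (ρ ^ j) + ENNReal.ofReal (ρ ^ j)⁻¹ *
          ENNReal.ofReal (incSq j fun t => X t ω) := by
      intro ω
      rw [ENNReal.ofReal_add hp.le (mul_nonneg (by positivity) (incSq_nonneg _ _)),
        ENNReal.ofReal_mul (by positivity)]
    simp_rw [e]
    rw [lintegral_add_left measurable_const, lintegral_const, measure_univ, mul_one,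
      lintegral_const_mul' _ _ ENNReal.ofReal_ne_top]
    refine (add_le_add_right (mul_le_mul_right (lintegral_incSq_le hX hC hκ hmom j) _) _).trans ?_
    rw [← ENNReal.ofReal_mul (by positivity), ← ENNReal.ofReal_add (by positivity) (by positivity)]
    refine ENNReal.ofReal_le_ofReal (le_of_eq ?_)
    rw [hρ2]
    field_simp
    ring
  have hpt : ∀ ω, edist (interp m fun k => X (node m k) ω)
        (interp (m + 1) fun k => X (node (m + 1) k) ω)
      ≤ ENNReal.ofReal (ρ ^ m + (ρ ^ m)⁻¹ * incSq m fun t => X t ω)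
        + 2 * ENNReal.ofReal (ρ ^ (m + 1) + (ρ ^ (m + 1))⁻¹ * incSq (m + 1) fun t => X t ω) := by
    intro ω
    have h := dist_interp_succ_le m (fun t => X t ω)
      (fun k hk => abs_inc_le (pow_pos hρ0 m) m (fun t => X t ω) hk)
      (fun k hk => abs_inc_le (pow_pos hρ0 (m + 1)) (m + 1) (fun t => X t ω) hk)
    rw [edist_dist]
    refine (ENNReal.ofReal_le_ofReal h).trans ?_
    refine ENNReal.ofReal_add_le.trans ?_
    rw [ENNReal.ofReal_mul (by norm_num), ENNReal.ofReal_ofNat]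
  refine (lintegral_mono hpt).trans ?_
  have hmeas : ∀ j, AEMeasurable (fun ω => ENNReal.ofReal
      (ρ ^ j + (ρ ^ j)⁻¹ * incSq j fun t => X t ω)) P := by
    intro j
    refine AEMeasurable.ennreal_ofReal (((Finset.aemeasurable_fun_sum _ fun k _ => ?_).const_mul
      _).const_add _)
    exact ((hX _).sub (hX _)).pow_const 2
  rw [lintegral_add_left' (hmeas m), lintegral_const_mul' _ _ (by simp)]
  refine (add_le_add (hRm m) (mul_le_mul_right (hRm (m + 1)) 2)).trans ?_
  rw [← ENNReal.ofReal_pow hρ0.le, ← ENNReal.ofReal_mul (by positivity), ← ENNReal.ofReal_ofNat,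
    ← ENNReal.ofReal_mul (by norm_num), ← ENNReal.ofReal_add (by positivity) (by positivity)]
  refine ENNReal.ofReal_le_ofReal ?_
  have : ρ ^ (m + 1) ≤ ρ ^ m := pow_le_pow_of_le_one hρ0.le hρ1 (Nat.le_succ m)
  nlinarith

/-- The geometric bound for the mean distance of a path to its dyadic interpolation. -/
def interpBound (C κ : ℝ) (m : ℕ) : ENNReal :=
  ∑' j : ℕ, ENNReal.ofReal (3 * (1 + 2 * C)) * ENNReal.ofReal ((2 : ℝ) ^ (-κ / 2)) ^ (m + j)

lemma interpBound_eq (C κ : ℝ) (m : ℕ) :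
    interpBound C κ m = ENNReal.ofReal ((2 : ℝ) ^ (-κ / 2)) ^ m * interpBound C κ 0 := by
  simp only [interpBound, pow_add, pow_zero, one_mul]
  rw [← ENNReal.tsum_mul_left]
  exact tsum_congr fun j => by ring

lemma interpBound_zero_ne_top (C : ℝ) {κ : ℝ} (hκ : 0 < κ) : interpBound C κ 0 ≠ ⊤ := by
  simp only [interpBound, zero_add]
  rw [ENNReal.tsum_mul_left, ENNReal.tsum_geometric]
  refine ENNReal.mul_ne_top ENNReal.ofReal_ne_top (ENNReal.inv_ne_top.2 ?_)
  refine (tsub_pos_of_lt ?_).ne'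
  rw [ENNReal.ofReal_lt_one]
  exact Real.rpow_lt_one_of_one_lt_of_neg (by norm_num) (by linarith)

lemma tendsto_interpBound (C : ℝ) {κ : ℝ} (hκ : 0 < κ) :
    Tendsto (interpBound C κ) atTop (𝓝 0) := by
  have h1 : ENNReal.ofReal ((2 : ℝ) ^ (-κ / 2)) < 1 := by
    rw [ENNReal.ofReal_lt_one]
    exact Real.rpow_lt_one_of_one_lt_of_neg (by norm_num) (by linarith)
  have h := ENNReal.Tendsto.mul_const (b := interpBound C κ 0)
    (ENNReal.tendsto_pow_atTop_nhds_zero_of_lt_one h1) (Or.inr (interpBound_zero_ne_top C hκ))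
  rw [zero_mul] at h
  exact h.congr fun m => (interpBound_eq C κ m).symm

/-- The interpolant is a continuous function of finitely many values of the process. -/
lemma aemeasurable_interp {X : unitInterval → Ω → ℝ} (hX : ∀ t, AEMeasurable (X t) P) (m : ℕ) :
    AEMeasurable (fun ω => interp m fun k => X (node m k) ω) P := by
  have hc : Continuous fun v : Fin (2 ^ m + 2) → ℝ => ∑ k, v k • hat m k := by fun_prop
  have hv : AEMeasurable (fun ω (k : Fin (2 ^ m + 2)) => X (node m k) ω) P :=
    aemeasurable_pi_lambda _ fun k => hX _
  refine (hc.measurable.comp_aemeasurable hv).congr (ae_of_all _ fun ω => ?_)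
  simp only [Function.comp, interp]
  rw [Finset.sum_range]

/-- A random element of `C[0,1]` is measurable as soon as its evaluations are. -/
lemma aemeasurable_of_eval {X : Ω → C(unitInterval, ℝ)}
    (hX : ∀ t, AEMeasurable (fun ω => X ω t) P) : AEMeasurable X P :=
  aemeasurable_of_tendsto_metrizable_ae' (fun m => aemeasurable_interp hX m)
    (ae_of_all _ fun ω => tendsto_interp (X ω))

/-- Telescoping over the finer levels. The bound depends only on `C`, `κ` and `m`, so it is uniform
over any family with a common moment estimate. -/
lemma lintegral_edist_interp_le [IsProbabilityMeasure P] {X : Ω → C(unitInterval, ℝ)}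
    (hX : ∀ t, AEMeasurable (fun ω => X ω t) P) {C κ : ℝ} (hC : 0 ≤ C) (hκ : 0 < κ)
    (hmom : ∀ s t, ∫⁻ ω, ENNReal.ofReal ((X ω t - X ω s) ^ 2) ∂P
      ≤ ENNReal.ofReal (C * |(t : ℝ) - s| ^ (1 + κ))) (m : ℕ) :
    ∫⁻ ω, edist (interp m fun k => X ω (node m k)) (X ω) ∂P ≤ interpBound C κ m := by
  have hpt : ∀ ω, edist (interp m fun k => X ω (node m k)) (X ω)
      ≤ ∑' j : ℕ, edist (interp (m + j) fun k => X ω (node (m + j) k))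
        (interp (m + j + 1) fun k => X ω (node (m + j + 1) k)) := fun ω =>
    edist_le_tsum_of_edist_le_of_tendsto
      (d := fun n => edist (interp n fun k => X ω (node n k))
        (interp (n + 1) fun k => X ω (node (n + 1) k))) (fun n => le_rfl) (tendsto_interp (X ω)) m
  refine (lintegral_mono hpt).trans ?_
  rw [lintegral_tsum fun j => (aemeasurable_interp hX _).edist (aemeasurable_interp hX _)]
  exact ENNReal.tsum_le_tsum fun j => lintegral_edist_interp_succ_le hX hC hκ hmom (m + j)

/-- Kolmogorov's continuity theorem for second moments. -/
lemma exists_continuous_modification [IsProbabilityMeasure P] {X : unitInterval → Ω → ℝ}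
    (hX : ∀ t, AEMeasurable (X t) P) {C κ : ℝ} (hC : 0 ≤ C) (hκ : 0 < κ)
    (hmom : ∀ s t, ∫⁻ ω, ENNReal.ofReal ((X t ω - X s ω) ^ 2) ∂P
      ≤ ENNReal.ofReal (C * |(t : ℝ) - s| ^ (1 + κ))) :
    ∃ ζ : Ω → C(unitInterval, ℝ), ∀ t, (fun ω => ζ ω t) =ᵐ[P] X t := by
  classical
  set I : ℕ → Ω → C(unitInterval, ℝ) := fun m ω => interp m fun k => X (node m k) ω with hI
  have hsum : ∫⁻ ω, ∑' m, edist (I m ω) (I (m + 1) ω) ∂P ≠ ⊤ := by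
    rw [lintegral_tsum fun j => (aemeasurable_interp hX _).edist (aemeasurable_interp hX _)]
    refine ne_top_of_le_ne_top (interpBound_zero_ne_top C hκ) ?_
    refine ENNReal.tsum_le_tsum fun j => ?_
    simpa using lintegral_edist_interp_succ_le hX hC hκ hmom j
  have hae := ae_lt_top' (AEMeasurable.tsum fun j =>
    (aemeasurable_interp hX j).edist (aemeasurable_interp hX (j + 1))) hsum
  have hconv : ∀ᵐ ω ∂P, ∃ z, Tendsto (fun m => I m ω) atTop (𝓝 z) := by
    filter_upwards [hae] with ω hω
    exact cauchySeq_tendsto_of_complete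
      (cauchySeq_of_edist_le_of_tsum_ne_top _ (fun n => le_rfl) hω.ne)
  let ζ : Ω → C(unitInterval, ℝ) := fun ω =>
    if h : ∃ z, Tendsto (fun m => I m ω) atTop (𝓝 z) then h.choose else 0
  refine ⟨ζ, fun t => ?_⟩
  have hlim : ∀ᵐ ω ∂P, Tendsto (fun m => I m ω t - X t ω) atTop (𝓝 (ζ ω t - X t ω)) := by
    filter_upwards [hconv] with ω hω
    have h1 : Tendsto (fun m => I m ω) atTop (𝓝 (ζ ω)) := by
      simp only [ζ, dif_pos hω]; exact hω.choose_spec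
    exact (((continuous_eval_const t).tendsto _).comp h1).sub_const _
  have hmI : ∀ m, AEMeasurable (fun ω => I m ω t - X t ω) P := fun m =>
    ((continuous_eval_const t).measurable.comp_aemeasurable
      (aemeasurable_interp hX m)).sub (hX t)
  -- The interpolants at `t` converge almost surely to `ζ ω t` and, by this bound, in mean square to
  -- `X t ω`; Fatou identifies the two limits.
  have hbound : ∀ m : ℕ, ∫⁻ ω, ENNReal.ofReal ((I m ω t - X t ω) ^ 2) ∂P
      ≤ ENNReal.ofReal (2 * (C * (1 / 2 ^ m) ^ (1 + κ))) := by
    intro m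
    set k := ⌊(2 : ℝ) ^ m * t⌋₊
    have hpt : ∀ ω, ENNReal.ofReal ((I m ω t - X t ω) ^ 2)
        ≤ ENNReal.ofReal ((X (node m k) ω - X t ω) ^ 2)
          + ENNReal.ofReal ((X (node m (k + 1)) ω - X t ω) ^ 2) := by
      intro ω
      rw [← ENNReal.ofReal_add (sq_nonneg _) (sq_nonneg _)]
      refine ENNReal.ofReal_le_ofReal ?_
      obtain ⟨θ, h0, h1, he⟩ := interp_apply_eq_convex m (fun k => X (node m k) ω) t
      simp only [hI]
      rw [he]
      set a := X (node m k) ω - X t ω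
      set b := X (node m (k + 1)) ω - X t ω
      have e : (1 - θ) * X (node m k) ω + θ * X (node m (k + 1)) ω - X t ω
          = (1 - θ) * a + θ * b := by simp only [a, b]; ring
      rw [e]
      -- Convexity of the square, with the weights then bounded by `1`.
      nlinarith [sq_nonneg (a - b), mul_nonneg h0 (sub_nonneg.2 h1), sq_nonneg a, sq_nonneg b,
        mul_nonneg (mul_nonneg h0 (sub_nonneg.2 h1)) (sq_nonneg (a - b)),
        mul_nonneg h0 (sq_nonneg a), mul_nonneg (sub_nonneg.2 h1) (sq_nonneg b)]
    refine (lintegral_mono hpt).trans ?_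
    have hd : ∀ s t, AEMeasurable (fun ω => X t ω - X s ω) P := fun s t => (hX t).sub (hX s)
    rw [lintegral_add_left' ((hd _ _).pow_const 2).ennreal_ofReal, two_mul,
      ENNReal.ofReal_add (by positivity) (by positivity)]
    refine add_le_add ((hmom _ _).trans ?_) ((hmom _ _).trans ?_) <;>
    · refine ENNReal.ofReal_le_ofReal ?_
      gcongr
      first | exact dist_node_floor_le m t | exact dist_node_floor_add_one_le m t
  have hb0 : Tendsto (fun m : ℕ => ENNReal.ofReal (2 * (C * (1 / 2 ^ m) ^ (1 + κ)))) atTop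
      (𝓝 0) := by
    have hl : Tendsto (fun m : ℕ => 1 / (2 : ℝ) ^ m) atTop (𝓝 0) := by
      have := tendsto_pow_atTop_nhds_zero_of_lt_one (r := (1 / 2 : ℝ)) (by norm_num) (by norm_num)
      simpa using this
    have h2 := ((hl.rpow_const (p := 1 + κ) (Or.inr (by linarith))).const_mul C).const_mul 2
    rw [Real.zero_rpow (by linarith), mul_zero, mul_zero] at h2
    simpa using ENNReal.tendsto_ofReal h2
  have hfatou : ∫⁻ ω, ENNReal.ofReal ((ζ ω t - X t ω) ^ 2) ∂P = 0 := by
    refine le_antisymm ?_ zero_le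
    have h1 : ∫⁻ ω, ENNReal.ofReal ((ζ ω t - X t ω) ^ 2) ∂P
        = ∫⁻ ω, liminf (fun m => ENNReal.ofReal ((I m ω t - X t ω) ^ 2)) atTop ∂P := by
      refine lintegral_congr_ae ?_
      filter_upwards [hlim] with ω hω
      exact (ENNReal.tendsto_ofReal (hω.pow 2)).liminf_eq.symm
    rw [h1]
    refine (lintegral_liminf_le' fun m => ((hmI m).pow_const 2).ennreal_ofReal).trans ?_
    refine (liminf_le_liminf (Eventually.of_forall hbound)).trans ?_
    rw [hb0.liminf_eq]
  have hζm : AEMeasurable (fun ω => ζ ω t - X t ω) P :=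
    aemeasurable_of_tendsto_metrizable_ae' hmI hlim
  have := (lintegral_eq_zero_iff' (hζm.pow_const 2).ennreal_ofReal).1 hfatou
  filter_upwards [this] with ω hω
  simp only [Pi.zero_apply, ENNReal.ofReal_eq_zero] at hω
  have h0 : ζ ω t - X t ω = 0 := by
    have := le_antisymm hω (sq_nonneg _)
    exact pow_eq_zero_iff two_ne_zero |>.1 this
  linarith

end Moments

/-! ### A criterion for weak convergence in `C[0,1]` -/

section Criterion

variable {Ω Ω' : Type*} [MeasurableSpace Ω] {P : Measure Ω} [IsProbabilityMeasure P]
  [MeasurableSpace Ω'] {P' : Measure Ω'} [IsProbabilityMeasure P']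

omit [IsProbabilityMeasure P] in
-- The Cramér–Wold device: a joint characteristic function is that of a linear combination at `1`.
lemma charFun_map_toLp {N : ℕ} {V : Fin N → Ω → ℝ} (hV : ∀ i, AEMeasurable (V i) P)
    (θ : EuclideanSpace ℝ (Fin N)) :
    charFun (P.map fun ω => WithLp.toLp 2 fun i => V i ω) θ
      = charFun (P.map fun ω => ∑ i, θ i * V i ω) 1 := by
  have h1 : AEMeasurable (fun ω => (WithLp.toLp 2 fun i => V i ω : EuclideanSpace ℝ (Fin N))) P :=
    (PiLp.continuous_toLp 2 _).measurable.comp_aemeasurable (aemeasurable_pi_lambda _ hV)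
  have h2 : AEMeasurable (fun ω => ∑ i, θ i * V i ω) P :=
    Finset.aemeasurable_fun_sum _ fun i _ => (hV i).const_mul _
  rw [charFun_apply, charFun_apply, integral_map h1 (by fun_prop), integral_map h2 (by fun_prop)]
  refine integral_congr_ae (ae_of_all _ fun ω => ?_)
  simp [PiLp.inner_apply]

lemma tendstoInDistribution_of_charFun {N : ℕ} {V : ℕ → Fin N → Ω → ℝ} {U : Fin N → Ω' → ℝ}
    (hV : ∀ n i, AEMeasurable (V n i) P) (hU : ∀ i, AEMeasurable (U i) P')
    (h : ∀ θ : Fin N → ℝ, Tendsto (fun n => charFun (P.map fun ω => ∑ i, θ i * V n i ω) 1) atTop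
      (𝓝 (charFun (P'.map fun ω => ∑ i, θ i * U i ω) 1))) :
    TendstoInDistribution
      (fun n ω => (WithLp.toLp 2 fun i => V n i ω : EuclideanSpace ℝ (Fin N))) atTop
      (fun ω => WithLp.toLp 2 fun i => U i ω) (fun _ => P) P' where
  forall_aemeasurable n :=
    (PiLp.continuous_toLp 2 _).measurable.comp_aemeasurable (aemeasurable_pi_lambda _ (hV n))
  aemeasurable_limit :=
    (PiLp.continuous_toLp 2 _).measurable.comp_aemeasurable (aemeasurable_pi_lambda _ hU)
  tendsto := by
    refine ProbabilityMeasure.tendsto_iff_tendsto_charFun.2 fun θ => ?_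
    simp only [ProbabilityMeasure.coe_mk]
    rw [charFun_map_toLp hU]
    simp_rw [charFun_map_toLp (hV _)]
    exact h θ

/-- Both laws come from the same probability space, so `(X, Y)` is a coupling and a mean distance
bound passes to Lipschitz functionals. -/
lemma abs_integral_sub_le_of_edist {X Y : Ω → C(unitInterval, ℝ)} (hX : AEMeasurable X P)
    (hY : AEMeasurable Y P) {F : C(unitInterval, ℝ) → ℝ} {M : ℝ}
    (hM : ∀ x y, dist (F x) (F y) ≤ M) {L : NNReal} (hL : LipschitzWith L F) {b : ENNReal}
    (hb : ∫⁻ ω, edist (X ω) (Y ω) ∂P ≤ b) (hbt : b ≠ ⊤) :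
    |∫ x, F x ∂(P.map X) - ∫ x, F x ∂(P.map Y)| ≤ L * b.toReal := by
  have hFb : ∀ x, ‖F x‖ ≤ ‖F 0‖ + M := by
    intro x
    have h1 := hM x 0
    rw [Real.dist_eq, ← Real.norm_eq_abs] at h1
    have h2 := norm_sub_norm_le (F x) (F 0)
    linarith
  have hint : ∀ {U : Ω → C(unitInterval, ℝ)}, AEMeasurable U P → Integrable (fun ω => F (U ω)) P :=
    fun hU => Integrable.of_bound
      (hL.continuous.measurable.comp_aemeasurable hU).aestronglyMeasurable _
      (ae_of_all _ fun ω => hFb _)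
  rw [integral_map hX hL.continuous.measurable.aestronglyMeasurable,
    integral_map hY hL.continuous.measurable.aestronglyMeasurable,
    ← integral_sub (hint hX) (hint hY), ← Real.norm_eq_abs]
  have h1 : ‖∫ ω, F (X ω) - F (Y ω) ∂P‖ₑ ≤ L * b := by
    refine (enorm_integral_le_lintegral_enorm _).trans ?_
    calc ∫⁻ ω, ‖F (X ω) - F (Y ω)‖ₑ ∂P ≤ ∫⁻ ω, L * edist (X ω) (Y ω) ∂P := by
          refine lintegral_mono fun ω => ?_
          rw [← edist_eq_enorm_sub]; exact hL _ _
      _ = L * ∫⁻ ω, edist (X ω) (Y ω) ∂P := lintegral_const_mul' _ _ (by simp)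
      _ ≤ L * b := by gcongr
  have h2 := ENNReal.toReal_mono (ENNReal.mul_ne_top (by simp) hbt) h1
  simpa using h2

/-- Weak convergence in `C[0,1]` from the convergence of the finite-dimensional characteristic
functions and a uniform bound on the second moments of the increments. -/
lemma tendstoInDistribution_of_moment_bound {X : ℕ → Ω → C(unitInterval, ℝ)}
    {ζ : Ω' → C(unitInterval, ℝ)} (hX : ∀ n t, AEMeasurable (fun ω => X n ω t) P)
    (hζ : ∀ t, AEMeasurable (fun ω => ζ ω t) P') {C κ : ℝ} (hC : 0 ≤ C) (hκ : 0 < κ)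
    (hXmom : ∀ n s t, ∫⁻ ω, ENNReal.ofReal ((X n ω t - X n ω s) ^ 2) ∂P
      ≤ ENNReal.ofReal (C * |(t : ℝ) - s| ^ (1 + κ)))
    (hζmom : ∀ s t, ∫⁻ ω, ENNReal.ofReal ((ζ ω t - ζ ω s) ^ 2) ∂P'
      ≤ ENNReal.ofReal (C * |(t : ℝ) - s| ^ (1 + κ)))
    (hfdd : ∀ (N : ℕ) (τ : Fin N → unitInterval) (θ : Fin N → ℝ),
      Tendsto (fun n => charFun (P.map fun ω => ∑ i, θ i * X n ω (τ i)) 1) atTop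
        (𝓝 (charFun (P'.map fun ω => ∑ i, θ i * ζ ω (τ i)) 1))) :
    TendstoInDistribution X atTop ζ (fun _ => P) P' := by
  have hXm : ∀ n, AEMeasurable (X n) P := fun n => aemeasurable_of_eval (hX n)
  have hζm : AEMeasurable ζ P' := aemeasurable_of_eval hζ
  refine ⟨hXm, hζm, ?_⟩
  refine tendsto_iff_forall_lipschitz_integral_tendsto.2 ?_
  rintro F ⟨M, hM⟩ ⟨L, hL⟩
  simp only [ProbabilityMeasure.coe_mk]
  have hint : ∀ m, Tendsto (fun n => ∫ x, F x ∂(P.map fun ω => interp m fun k => X n ω (node m k)))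
      atTop (𝓝 (∫ x, F x ∂(P'.map fun ω => interp m fun k => ζ ω (node m k)))) := by
    intro m
    have hd := tendstoInDistribution_of_charFun (N := 2 ^ m + 2)
      (V := fun n i ω => X n ω (node m i)) (U := fun i ω => ζ ω (node m i))
      (fun n i => hX n _) (fun i => hζ _) fun θ => hfdd _ (fun i => node m i) θ
    have hc : Continuous fun v : EuclideanSpace ℝ (Fin (2 ^ m + 2)) => ∑ k, v k • hat m k := by
      fun_prop
    have hd3 := tendsto_iff_forall_lipschitz_integral_tendsto.1 (hd.continuous_comp hc).tendsto
      F ⟨M, hM⟩ ⟨L, hL⟩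
    simp only [ProbabilityMeasure.coe_mk] at hd3
    have e : ∀ v : ℕ → ℝ, interp m v = ∑ k : Fin (2 ^ m + 2), v k • hat m k := fun v => by
      rw [interp, Finset.sum_range]
    simp_rw [e]
    exact hd3
  have hbt : ∀ m, interpBound C κ m ≠ ⊤ := fun m => by
    rw [interpBound_eq]
    exact ENNReal.mul_ne_top (ENNReal.pow_ne_top ENNReal.ofReal_ne_top)
      (interpBound_zero_ne_top C hκ)
  have hb0 : Tendsto (fun m => L * (interpBound C κ m).toReal) atTop (𝓝 0) := by
    have := (ENNReal.tendsto_toReal ENNReal.zero_ne_top).comp (tendsto_interpBound C hκ)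
    simpa using this.const_mul (L : ℝ)
  have h1 : ∀ n m, |∫ x, F x ∂(P.map fun ω => interp m fun k => X n ω (node m k))
      - ∫ x, F x ∂(P.map (X n))| ≤ L * (interpBound C κ m).toReal := fun n m =>
    abs_integral_sub_le_of_edist (aemeasurable_interp (hX n) m) (hXm n) hM hL
      (lintegral_edist_interp_le (hX n) hC hκ (hXmom n) m) (hbt m)
  have h2 : ∀ m, |∫ x, F x ∂(P'.map fun ω => interp m fun k => ζ ω (node m k))
      - ∫ x, F x ∂(P'.map ζ)| ≤ L * (interpBound C κ m).toReal := fun m =>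
    abs_integral_sub_le_of_edist (aemeasurable_interp hζ m) hζm hM hL
      (lintegral_edist_interp_le hζ hC hκ hζmom m) (hbt m)
  rw [Metric.tendsto_atTop]
  intro ε hε
  -- The level `m` is fixed first, which is legitimate because the interpolation error is uniform in
  -- `n`; only then does `n` tend to infinity.
  obtain ⟨m, hm⟩ := (hb0.eventually_lt_const (by positivity : 0 < ε / 3)).exists
  obtain ⟨N, hN⟩ := Metric.tendsto_atTop.1 (hint m) (ε / 3) (by positivity)
  refine ⟨N, fun n hn => ?_⟩
  have a1 := hN n hn
  have a2 := h1 n m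
  have a3 := h2 m
  rw [Real.dist_eq] at a1 ⊢
  rw [abs_lt] at a1 ⊢
  rw [abs_le] at a2 a3
  constructor <;> linarith

end Criterion

/-! ### The coefficients of the fractional difference operator -/

lemma multichoose_eq_prod_div (α : ℝ) (j : ℕ) :
    Ring.multichoose α j = (∏ i ∈ Finset.range j, (α + i)) / (j.factorial : ℝ) := by
  have h := Ring.factorial_nsmul_multichoose_eq_ascPochhammer α j
  rw [Polynomial.ascPochhammer_smeval_eq_eval] at h
  have hp : ∀ j : ℕ, (ascPochhammer ℝ j).eval α = ∏ i ∈ Finset.range j, (α + i) := by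
    intro j
    induction j with
    | zero => simp
    | succ j ih => rw [ascPochhammer_succ_eval, ih, Finset.prod_range_succ]
  rw [hp, nsmul_eq_mul] at h
  rw [eq_div_iff (by positivity), ← h, mul_comm]

lemma multichoose_nonneg {α : ℝ} (hα : 0 < α) (j : ℕ) : 0 ≤ Ring.multichoose α j := by
  rw [multichoose_eq_prod_div]
  exact div_nonneg (Finset.prod_nonneg fun i _ => by positivity) (by positivity)

/-- The alternating sign cancels against that of `binom(-α, j)`, so the coefficients are
nonnegative. -/
lemma coeff_neg_eq (α μ : ℝ) (j : ℕ) :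
    coeff (-α) μ j = Ring.multichoose α j * Real.exp (-(μ * j)) := by
  rw [coeff, Ring.choose_neg', Int.negOnePow_def, Units.smul_def, zsmul_eq_mul, zpow_natCast]
  push_cast
  rw [← mul_assoc, ← mul_pow]
  simp

/-- Asymptotics of the binomial coefficients: `binom(α + j - 1, j) ~ j^(α - 1) / Γ(α)`. -/
lemma tendsto_multichoose_mul_rpow {α : ℝ} (hα : 0 < α) :
    Tendsto (fun j : ℕ => Ring.multichoose α j * (j : ℝ) ^ (1 - α)) atTop
      (𝓝 (Real.Gamma α)⁻¹) := by
  -- Euler's product contains the factors `α + i` for `i ≤ j`; multiplying its inverse by `j / (α +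
  -- j)` removes the last one and supplies the power `j^(1-α)`.
  have h1 := (Real.GammaSeq_tendsto_Gamma α).inv₀ (Real.Gamma_pos_of_pos hα).ne'
  have h2 : Tendsto (fun j : ℕ => (j : ℝ) / (α + j)) atTop (𝓝 1) := by
    have := tendsto_natCast_div_add_atTop (𝕜 := ℝ) α
    simpa [add_comm] using this
  have h3 := h2.mul h1
  rw [one_mul] at h3
  refine h3.congr' ?_
  filter_upwards [eventually_gt_atTop 0] with j hj
  have hj' : (0 : ℝ) < j := by exact_mod_cast hj
  have hp : (∏ i ∈ Finset.range j, (α + (i : ℝ))) ≠ 0 :=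
    (Finset.prod_pos fun i _ => by positivity).ne'
  rw [Real.GammaSeq, Finset.prod_range_succ, multichoose_eq_prod_div, Real.rpow_sub hj',
    Real.rpow_one]
  have hr : (j : ℝ) ^ α ≠ 0 := (Real.rpow_pos_of_pos hj' α).ne'
  have hs : α + (j : ℝ) ≠ 0 := by positivity
  have hfac : (j.factorial : ℝ) ≠ 0 := by positivity
  field_simp

/-- Convergent sequences are bounded; the shift to `j + 1` makes the power law meaningful at `j = 0`
as well. -/
lemma exists_multichoose_le {α : ℝ} (hα : 0 < α) :
    ∃ K : ℝ, 1 ≤ K ∧ ∀ j : ℕ, Ring.multichoose α j ≤ K * ((j : ℝ) + 1) ^ (α - 1) := by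
  have h1 := tendsto_multichoose_mul_rpow hα
  have h2 : Tendsto (fun j : ℕ => (((j : ℝ) + 1) / j) ^ (1 - α)) atTop (𝓝 1) := by
    have h3 : Tendsto (fun j : ℕ => ((j : ℝ) + 1) / j) atTop (𝓝 1) := by
      have := (tendsto_natCast_div_add_atTop (𝕜 := ℝ) 1).inv₀ one_ne_zero
      simpa [inv_div] using this
    simpa using h3.rpow_const (p := 1 - α) (Or.inl one_ne_zero)
  obtain ⟨K, hK⟩ := (h1.mul h2).bddAbove_range
  have hb : ∃ K' : ℝ, ∀ j : ℕ, Ring.multichoose α j * ((j : ℝ) + 1) ^ (1 - α) ≤ K' := by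
    refine ⟨max K (Ring.multichoose α 0), fun j => ?_⟩
    rcases Nat.eq_zero_or_pos j with rfl | hj
    · simp
    · refine le_trans (le_of_eq ?_) ((hK ⟨j, rfl⟩).trans (le_max_left _ _))
      have hj' : (0 : ℝ) < j := by exact_mod_cast hj
      simp only
      rw [mul_assoc, ← Real.mul_rpow hj'.le (by positivity)]
      congr 2
      field_simp
  obtain ⟨K', hK'⟩ := hb
  refine ⟨max 1 K', le_max_left _ _, fun j => ?_⟩
  have hj : (0 : ℝ) < (j : ℝ) + 1 := by positivity
  have := (hK' j).trans (le_max_right 1 K')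
  have e : ((j : ℝ) + 1) ^ (α - 1) = (((j : ℝ) + 1) ^ (1 - α))⁻¹ := by
    rw [← Real.rpow_neg hj.le]; congr 1; ring
  rw [e, ← div_eq_mul_inv, le_div_iff₀ (Real.rpow_pos_of_pos hj _)]
  exact this

/-- When `α > 1` the kernel grows polynomially, and half of the exponential tempering is spent on
absorbing this growth. -/
lemma exists_rpow_le_exp (r : ℝ) {μ : ℝ} (hμ : 0 < μ) :
    ∃ C : ℝ, 1 ≤ C ∧ ∀ x : ℝ, 0 ≤ x → (x + 2) ^ r ≤ C * Real.exp (μ * x) := by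
  rcases le_or_gt r 0 with hr | hr
  · refine ⟨1, le_rfl, fun x hx => ?_⟩
    have h1 : (x + 2) ^ r ≤ 1 := Real.rpow_le_one_of_one_le_of_nonpos (by linarith) hr
    have h2 : 1 ≤ Real.exp (μ * x) := Real.one_le_exp (by positivity)
    linarith
  · refine ⟨max 1 ((r / μ) ^ r * Real.exp (μ * 2)), le_max_left _ _, fun x hx => ?_⟩
    have hv : 0 < x + 2 := by linarith
    have h1 : x + 2 ≤ (r / μ) * Real.exp ((μ / r) * (x + 2)) := by
      have := Real.add_one_le_exp ((μ / r) * (x + 2))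
      calc x + 2 = (r / μ) * ((μ / r) * (x + 2)) := by field_simp
        _ ≤ _ := by gcongr; linarith
    calc (x + 2) ^ r ≤ ((r / μ) * Real.exp ((μ / r) * (x + 2))) ^ r :=
          Real.rpow_le_rpow hv.le h1 hr.le
      _ = (r / μ) ^ r * Real.exp (μ * 2) * Real.exp (μ * x) := by
          rw [Real.mul_rpow (by positivity) (Real.exp_pos _).le, ← Real.exp_mul,
            mul_assoc ((r / μ) ^ r),
            ← Real.exp_add]
          congr 2
          field_simp
          ring
      _ ≤ _ := by gcongr; exact le_max_right _ _

/-! ### Windowed masses of a translated function -/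

/-- The mass of the window between `a` and `b` under the translate of `h` to `y`. -/
def windowMass (h : ℝ → ENNReal) (a b y : ℝ) : ENNReal := ∫⁻ u in Set.uIoc a b, h (u - y)

lemma measurable_windowMass {h : ℝ → ENNReal} (hh : Measurable h) (a b : ℝ) :
    Measurable (windowMass h a b) := by
  have : Measurable fun p : ℝ × ℝ => h (p.2 - p.1) := by fun_prop
  exact this.lintegral_prod_right'

/-- Tonelli, and invariance of Lebesgue measure under `y ↦ u - y`. -/
lemma lintegral_windowMass {h : ℝ → ENNReal} (hh : Measurable h) (a b : ℝ) :
    ∫⁻ y, windowMass h a b y = ENNReal.ofReal |b - a| * ∫⁻ u, h u := by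
  unfold windowMass
  rw [lintegral_lintegral_swap (by fun_prop)]
  have : ∀ u : ℝ, ∫⁻ y, h (u - y) = ∫⁻ y, h y := fun u => lintegral_sub_left_eq_self h u
  simp_rw [this]
  rw [lintegral_const, mul_comm, Measure.restrict_apply_univ, Set.uIoc, Real.volume_Ioc,
    max_sub_min_eq_abs]

/-- Hölder against the constant `1` on the window; the bound is uniform in `y`. -/
lemma windowMass_le {h : ℝ → ENNReal} (hh : Measurable h) {q : ℝ} (hq : 1 < q) (a b y : ℝ) :
    windowMass h a b y ≤ (∫⁻ u, h u ^ q) ^ (1 / q) * ENNReal.ofReal |b - a| ^ (1 - 1 / q) := by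
  have hpq : q.HolderConjugate (q.conjExponent) := Real.HolderConjugate.conjExponent hq
  have := ENNReal.lintegral_mul_le_Lp_mul_Lq (volume.restrict (Set.uIoc a b)) hpq
    (f := fun u => h (u - y)) (g := fun _ => 1) (by fun_prop) (by fun_prop)
  simp only [Pi.mul_apply, mul_one, ENNReal.one_rpow, lintegral_const, one_mul,
    Measure.restrict_apply_univ] at this
  refine this.trans ?_
  have e1 : 1 / q.conjExponent = 1 - 1 / q := by
    have := hpq.inv_add_inv_eq_one
    rw [one_div, one_div]; linarith
  rw [e1, Set.uIoc, Real.volume_Ioc, max_sub_min_eq_abs]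
  refine mul_le_mul_left (ENNReal.rpow_le_rpow ?_ (by positivity)) _
  refine (setLIntegral_le_lintegral _ _).trans (le_of_eq ?_)
  exact lintegral_sub_right_eq_self (fun u => h u ^ q) y

lemma enorm_intervalIntegral_le_windowMass {h : ℝ → ENNReal} {g : ℝ → ℝ} {y : ℝ}
    (hg : ∀ s, s ≠ y → ‖g s‖ₑ ≤ h (s - y)) (a b : ℝ) :
    ‖∫ s in a..b, g s‖ₑ ≤ windowMass h a b y := by
  have h1 : ‖∫ s in a..b, g s‖ₑ = ‖∫ s in Set.uIoc a b, g s‖ₑ := by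
    rw [← ofReal_norm, ← ofReal_norm, intervalIntegral.norm_intervalIntegral_eq]
  rw [h1]
  refine (enorm_integral_le_lintegral_enorm _).trans ?_
  refine lintegral_mono_ae (ae_restrict_of_ae ?_)
  filter_upwards [compl_mem_ae_iff.2 (measure_singleton y)] with s hs
  exact hg s hs

lemma intervalIntegrable_of_le {h : ℝ → ENNReal} (hI : ∫⁻ u, h u ≠ ⊤) {g : ℝ → ℝ} {y : ℝ}
    (hgm : Measurable g) (hg : ∀ s, s ≠ y → ‖g s‖ₑ ≤ h (s - y)) (a b : ℝ) :
    IntervalIntegrable g volume a b := by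
  have : Integrable g := by
    refine ⟨hgm.aestronglyMeasurable, lt_of_le_of_lt (lintegral_mono_ae ?_)
      (lt_top_iff_ne_top.2 ((lintegral_sub_right_eq_self h y).trans_ne hI))⟩
    filter_upwards [compl_mem_ae_iff.2 (measure_singleton y)] with s hs
    exact hg s hs
  exact this.intervalIntegrable

/-- The increments in `t` of a kernel `∫_0^t G(s, y) ds` with `G` dominated by a translation
invariant function are small in `L²`. -/
lemma lintegral_sq_increment_le {h : ℝ → ENNReal} (hh : Measurable h) (hI : ∫⁻ u, h u ≠ ⊤)
    {q : ℝ} (hq : 1 < q) {G : ℝ → ℝ → ℝ} (hGm : ∀ y, Measurable fun s => G s y)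
    (hG : ∀ s y, s ≠ y → ‖G s y‖ₑ ≤ h (s - y)) (s t : ℝ) :
    ∫⁻ y, ‖(∫ u in (0 : ℝ)..t, G u y) - ∫ u in (0 : ℝ)..s, G u y‖ₑ ^ 2
      ≤ (∫⁻ u, h u ^ q) ^ (1 / q) * (∫⁻ u, h u) * ENNReal.ofReal |t - s| ^ (1 + (1 - 1 / q)) := by
  -- One of the two factors is bounded uniformly, a gain of `|t - s|^(1 - 1/q)`; the other is kept,
  -- and its integral over `y` contributes a full power of `|t - s|`.
  have hpt : ∀ y, ‖(∫ u in (0 : ℝ)..t, G u y) - ∫ u in (0 : ℝ)..s, G u y‖ₑ ^ 2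
      ≤ (∫⁻ u, h u ^ q) ^ (1 / q) * ENNReal.ofReal |t - s| ^ (1 - 1 / q) * windowMass h s t y := by
    intro y
    have hint := intervalIntegrable_of_le hI (hGm y) fun u hu => hG u y hu
    rw [intervalIntegral.integral_interval_sub_left (hint _ _) (hint _ _), sq]
    have := enorm_intervalIntegral_le_windowMass (fun u hu => hG u y hu) s t
    gcongr
    exact this.trans (windowMass_le hh hq s t y)
  refine (lintegral_mono hpt).trans ?_
  rw [lintegral_const_mul _ (measurable_windowMass hh s t), lintegral_windowMass hh,
    ENNReal.rpow_add_of_nonneg 1 _ zero_le_one, ENNReal.rpow_one]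
  · exact le_of_eq (by ring)
  · rw [sub_nonneg, div_le_one (by linarith)]; exact hq.le

lemma lintegral_sq_windowMass_ne_top {h : ℝ → ENNReal} (hh : Measurable h) (hI : ∫⁻ u, h u ≠ ⊤)
    (a b : ℝ) : ∫⁻ y, windowMass h a b y ^ 2 ≠ ⊤ := by
  have hle : ∀ y, windowMass h a b y ≤ ∫⁻ u, h u := fun y =>
    (setLIntegral_le_lintegral _ _).trans (lintegral_sub_right_eq_self h y).le
  have hpt : ∀ y, windowMass h a b y ^ 2 ≤ (∫⁻ u, h u) * windowMass h a b y := by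
    intro y; rw [sq]; gcongr; exact hle y
  refine ne_top_of_le_ne_top ?_ (lintegral_mono hpt)
  rw [lintegral_const_mul _ (measurable_windowMass hh a b), lintegral_windowMass hh]
  exact ENNReal.mul_ne_top hI (ENNReal.mul_ne_top ENNReal.ofReal_ne_top hI)

lemma windowMass_mono {h : ℝ → ENNReal} {t : ℝ} (ht : t ∈ Set.Icc (0 : ℝ) 1) (y : ℝ) :
    windowMass h 0 t y ≤ windowMass h 0 1 y := by
  refine lintegral_mono_set ?_
  rw [Set.uIoc_of_le ht.1, Set.uIoc_of_le zero_le_one]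
  exact Set.Ioc_subset_Ioc_right ht.2

/-- `L²` convergence of the finite linear combinations of kernels `∫_0^t G_n(s, y) ds`. -/
lemma tendsto_lintegral_sq_kernel {h : ℝ → ENNReal} (hh : Measurable h) (hI : ∫⁻ u, h u ≠ ⊤)
    {G : ℕ → ℝ → ℝ → ℝ} {G' : ℝ → ℝ → ℝ} (hGm : ∀ n y, Measurable fun s => G n s y)
    (hGm' : ∀ n t, Measurable fun y => ∫ u in (0 : ℝ)..t, G n u y)
    (hG : ∀ n s y, s ≠ y → ‖G n s y‖ₑ ≤ h (s - y))
    (hlim : ∀ s y, s ≠ y → Tendsto (fun n => G n s y) atTop (𝓝 (G' s y)))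
    {N : ℕ} (τ : Fin N → unitInterval) (θ : Fin N → ℝ) :
    Tendsto (fun n => ∫⁻ y, ‖∑ i, θ i * ∫ u in (0 : ℝ)..τ i, G n u y‖ₑ ^ 2) atTop
      (𝓝 (∫⁻ y, ‖∑ i, θ i * ∫ u in (0 : ℝ)..τ i, G' u y‖ₑ ^ 2)) := by
  refine tendsto_lintegral_of_dominated_convergence
    (fun y => (∑ i, ‖θ i‖ₑ) ^ 2 * windowMass h 0 1 y ^ 2) ?_ ?_ ?_ ?_
  · intro n
    exact ((Finset.measurable_fun_sum _ fun i _ => (hGm' n _).const_mul _).enorm).pow_const 2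
  · intro n
    refine ae_of_all _ fun y => ?_
    simp only
    rw [← mul_pow]
    gcongr
    refine (enorm_sum_le _ _).trans ?_
    rw [Finset.sum_mul]
    refine Finset.sum_le_sum fun i _ => ?_
    rw [enorm_mul]
    gcongr
    exact (enorm_intervalIntegral_le_windowMass (fun u hu => hG n u y hu) _ _).trans
      (windowMass_mono (τ i).2 y)
  · rw [lintegral_const_mul _ ((measurable_windowMass hh 0 1).pow_const 2)]
    refine ENNReal.mul_ne_top (ENNReal.pow_ne_top ?_) (lintegral_sq_windowMass_ne_top hh hI 0 1)
    exact (ENNReal.sum_lt_top.2 fun i _ => enorm_lt_top).ne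
  · refine ae_of_all _ fun y => ?_
    have hne : ∀ᵐ s : ℝ, s ≠ y := compl_mem_ae_iff.2 (measure_singleton y)
    have hhy : ∫⁻ s, h (s - y) ≠ ⊤ := (lintegral_sub_right_eq_self h y).trans_ne hI
    have hhm : Measurable fun s => h (s - y) := by fun_prop
    have hfin : ∀ᵐ s : ℝ, h (s - y) < ⊤ := ae_lt_top hhm hhy
    -- An inner dominated convergence in `s` for fixed `y` supplies the pointwise limit for the
    -- outer one in `y`.
    have hconv : ∀ t : ℝ, Tendsto (fun n => ∫ u in (0 : ℝ)..t, G n u y) atTop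
        (𝓝 (∫ u in (0 : ℝ)..t, G' u y)) := by
      intro t
      refine intervalIntegral.tendsto_integral_filter_of_dominated_convergence
        (fun s => (h (s - y)).toReal) ?_ ?_ ?_ ?_
      · exact Eventually.of_forall fun n => (hGm n y).aestronglyMeasurable
      · refine Eventually.of_forall fun n => ?_
        filter_upwards [hne, hfin] with s hs hs' _
        have := ENNReal.toReal_mono hs'.ne (hG n s y hs)
        simpa using this
      · exact (integrable_toReal_of_lintegral_ne_top hhm.aemeasurable hhy).intervalIntegrable
      · filter_upwards [hne] with s hs _
        exact hlim s y hs
    have hsum : Tendsto (fun n => ∑ i, θ i * ∫ u in (0 : ℝ)..τ i, G n u y) atTop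
        (𝓝 (∑ i, θ i * ∫ u in (0 : ℝ)..τ i, G' u y)) :=
      tendsto_finsetSum _ fun i _ => (hconv _).const_mul _
    exact ((ENNReal.continuous_pow 2).tendsto _).comp ((continuous_enorm.tendsto _).comp hsum)

/-! ### The dominating function -/

/-- The function that dominates the tempered kernels. -/
def domFn (K α lam : ℝ) (u : ℝ) : ENNReal :=
  ENNReal.ofReal (K * ((|u| ^ (α - 1) + 1) * Real.exp (-(lam / 2 * |u|))))

lemma measurable_domFn (K α lam : ℝ) : Measurable (domFn K α lam) := by
  unfold domFn
  fun_prop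

lemma integrable_comp_abs_of_integrableOn {f : ℝ → ℝ} (hf : IntegrableOn f (Set.Ioi 0)) :
    Integrable fun u : ℝ => f |u| := by
  have h1 : IntegrableOn (fun x => f |x|) (Set.Ioi 0) :=
    hf.congr_fun (fun x hx => by rw [abs_of_pos (Set.mem_Ioi.1 hx)]) measurableSet_Ioi
  have h2 : IntegrableOn (fun x => f |x|) (Set.Iic 0) := by
    rw [integrableOn_Iic_iff_integrableOn_Iio]
    have := (neg_zero (G := ℝ) ▸ h1 : IntegrableOn (fun x => f |x|) (Set.Ioi (-0))).comp_neg_Iio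
    simpa using this
  rw [← integrableOn_univ, ← Set.Iic_union_Ioi (a := (0 : ℝ))]
  exact h2.union h1

lemma integrable_abs_rpow_mul_exp {s b : ℝ} (hs : -1 < s) (hb : 0 < b) :
    Integrable fun u : ℝ => |u| ^ s * Real.exp (-(b * |u|)) := by
  have h := integrableOn_rpow_mul_exp_neg_mul_rpow hs zero_lt_one hb
  simp only [Real.rpow_one] at h
  have := integrable_comp_abs_of_integrableOn h
  simpa using this

/-- `(a + 1)^q ≤ 2^q (a^q + 1)` separates the singularity from the bounded part; `hqα` is
integrability at `0`, and tempering handles infinity. -/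
lemma lintegral_domFn_rpow_ne_top {K α lam q : ℝ} (hK : 0 ≤ K) (hlam : 0 < lam) (hq : 1 ≤ q)
    (hqα : -1 < q * (α - 1)) : ∫⁻ u, domFn K α lam u ^ q ≠ ⊤ := by
  have hq0 : 0 ≤ q := by linarith
  have hb : 0 < q * (lam / 2) := by positivity
  have hint : Integrable fun u : ℝ => K ^ q * 2 ^ q *
      (|u| ^ (q * (α - 1)) * Real.exp (-(q * (lam / 2) * |u|))
        + |u| ^ (0 : ℝ) * Real.exp (-(q * (lam / 2) * |u|))) :=
    ((integrable_abs_rpow_mul_exp hqα hb).add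
      (integrable_abs_rpow_mul_exp (by norm_num) hb)).const_mul _
  have hpt : ∀ u : ℝ, domFn K α lam u ^ q ≤ ‖K ^ q * 2 ^ q *
      (|u| ^ (q * (α - 1)) * Real.exp (-(q * (lam / 2) * |u|))
        + |u| ^ (0 : ℝ) * Real.exp (-(q * (lam / 2) * |u|)))‖ₑ := by
    intro u
    have ha : 0 ≤ |u| ^ (α - 1) := Real.rpow_nonneg (abs_nonneg u) _
    rw [domFn, ENNReal.ofReal_rpow_of_nonneg (by positivity) hq0, Real.enorm_eq_ofReal
      (by positivity)]
    refine ENNReal.ofReal_le_ofReal ?_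
    rw [Real.mul_rpow hK (by positivity), Real.mul_rpow (by positivity) (Real.exp_pos _).le,
      ← Real.exp_mul, Real.rpow_zero, one_mul, mul_assoc (K ^ q)]
    refine mul_le_mul_of_nonneg_left ?_ (Real.rpow_nonneg hK q)
    have e : -(lam / 2 * |u|) * q = -(q * (lam / 2) * |u|) := by ring
    have e2 : |u| ^ (q * (α - 1)) = (|u| ^ (α - 1)) ^ q := by
      rw [← Real.rpow_mul (abs_nonneg u), mul_comm q]
    rw [e, ← add_one_mul, ← mul_assoc, e2]
    refine mul_le_mul_of_nonneg_right ?_ (Real.exp_pos _).le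
    set a := |u| ^ (α - 1)
    have h1 : (a + 1) ^ q ≤ (2 * max a 1) ^ q :=
      Real.rpow_le_rpow (by positivity) (by linarith [le_max_left a 1, le_max_right a 1]) hq0
    refine h1.trans ?_
    rw [Real.mul_rpow (by norm_num) (by positivity)]
    refine mul_le_mul_of_nonneg_left ?_ (by positivity)
    have haq : 0 ≤ a ^ q := Real.rpow_nonneg ha q
    rcases max_cases a 1 with h | h <;> rw [h.1]
    · linarith
    · rw [Real.one_rpow]; linarith
  refine ne_top_of_le_ne_top hint.2.ne (lintegral_mono hpt)

lemma lintegral_domFn_ne_top {K α lam : ℝ} (hK : 0 ≤ K) (hα : 0 < α) (hlam : 0 < lam) :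
    ∫⁻ u, domFn K α lam u ≠ ⊤ := by
  simpa using lintegral_domFn_rpow_ne_top (q := 1) hK hlam le_rfl (by linarith)

/-! ### The rescaled coefficients -/

/-- The rescaled coefficients of the ARTFIMA series, as a function on `ℤ`. -/
def stepKernel (α lam : ℝ) (n : ℕ) (j : ℤ) : ℝ :=
  if 0 ≤ j then (n : ℝ) ^ (1 - α) * coeff (-α) (lam / n) j.toNat else 0

/-- The tempered fractional kernel. -/
def temperedKernel (α lam s y : ℝ) : ℝ :=
  if 0 < s - y then (s - y) ^ (α - 1) * Real.exp (-(lam * (s - y))) else 0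

lemma floor_sub_floor_bounds (n s y : ℝ) :
    n * (s - y) - 1 < ((⌊n * s⌋ - ⌊n * y⌋ : ℤ) : ℝ) ∧
      ((⌊n * s⌋ - ⌊n * y⌋ : ℤ) : ℝ) < n * (s - y) + 1 := by
  have h1 := Int.floor_le (n * s)
  have h2 := Int.lt_floor_add_one (n * s)
  have h3 := Int.floor_le (n * y)
  have h4 := Int.lt_floor_add_one (n * y)
  push_cast
  constructor <;> nlinarith

/-- For an index `i ≥ 0`, the quantity `v = (i + 1) / n` lies between `|u|` and `|u| + 2`, where `u
= s - y`. So `v^(α-1)` is at most `|u|^(α-1)` for `α ≤ 1` and at most `(|u| + 2)^(α-1)` for `α > 1`.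
Replacing `i / n` by `|u| - 1` in the exponential costs the factor `e^lam`. -/
lemma exists_enorm_stepKernel_le {α lam : ℝ} (hα : 0 < α) (hlam : 0 < lam) :
    ∃ K : ℝ, 1 ≤ K ∧ ∀ n : ℕ, 1 ≤ n → ∀ s y : ℝ, s ≠ y →
      ‖stepKernel α lam n (⌊n * s⌋ - ⌊n * y⌋)‖ₑ ≤ domFn K α lam (s - y) := by
  obtain ⟨K, hK1, hK⟩ := exists_multichoose_le hα
  obtain ⟨C, hC1, hC⟩ := exists_rpow_le_exp (α - 1) (half_pos hlam)
  have hlam' : 1 ≤ Real.exp lam := Real.one_le_exp hlam.le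
  refine ⟨K * Real.exp lam * C, by
    nlinarith [mul_le_mul hK1 hlam' zero_le_one (by linarith),
      mul_nonneg (by linarith : (0 : ℝ) ≤ K) (Real.exp_pos lam).le], fun n hn s y hsy => ?_⟩
  set j : ℤ := ⌊(n : ℝ) * s⌋ - ⌊(n : ℝ) * y⌋ with hj
  have hn' : (1 : ℝ) ≤ n := by exact_mod_cast hn
  have hn0 : (0 : ℝ) < n := by linarith
  unfold stepKernel
  split_ifs with h0
  swap
  · simp
  obtain ⟨b1, b2⟩ := floor_sub_floor_bounds n s y
  rw [← hj] at b1 b2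
  set u := s - y with hu
  have hu0 : u ≠ 0 := sub_ne_zero.2 hsy
  have hua : 0 < |u| := abs_pos.2 hu0
  obtain ⟨i, hi⟩ := Int.eq_ofNat_of_zero_le h0
  rw [hi] at b1 b2
  rw [hi, Int.toNat_natCast]
  push_cast at b1 b2
  set v : ℝ := ((i : ℝ) + 1) / n with hv
  have hi0 : (0 : ℝ) ≤ i := Nat.cast_nonneg i
  have hv1 : |u| ≤ v := by
    rw [hv, le_div_iff₀ hn0]
    rcases abs_cases u with h | h <;> rw [h.1] <;> nlinarith
  have hv2 : v ≤ |u| + 2 := by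
    rw [hv, div_le_iff₀ hn0]
    have := le_abs_self u
    nlinarith
  have hv0 : 0 < v := hua.trans_le hv1
  have hcoef : (n : ℝ) ^ (1 - α) * coeff (-α) (lam / n) i
      ≤ K * v ^ (α - 1) * Real.exp (-(lam / n * i)) := by
    rw [coeff_neg_eq, ← mul_assoc]
    refine mul_le_mul_of_nonneg_right ?_ (Real.exp_pos _).le
    calc (n : ℝ) ^ (1 - α) * Ring.multichoose α i
        ≤ (n : ℝ) ^ (1 - α) * (K * ((i : ℝ) + 1) ^ (α - 1)) := by gcongr; exact hK i
      _ = K * v ^ (α - 1) := by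
          rw [hv, Real.div_rpow (by positivity) hn0.le,
            show (1 - α) = -(α - 1) by ring, Real.rpow_neg hn0.le]
          ring
  have hexp : Real.exp (-(lam / n * i)) ≤ Real.exp lam * Real.exp (-(lam * |u|)) := by
    rw [← Real.exp_add, Real.exp_le_exp]
    have h1 : |u| ≤ i / n + 1 := by
      refine hv1.trans ?_
      rw [hv, add_div]
      have : 1 / (n : ℝ) ≤ 1 := by rw [div_le_one hn0]; exact hn'
      linarith
    have h2 : lam / n * i = lam * (i / n) := by ring
    rw [h2]
    nlinarith
  have hvr : v ^ (α - 1) ≤ |u| ^ (α - 1) + C * Real.exp (lam / 2 * |u|) := by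
    rcases le_or_gt (α - 1) 0 with hr | hr
    · have := Real.rpow_le_rpow_of_nonpos hua hv1 hr
      have : 0 ≤ C * Real.exp (lam / 2 * |u|) := mul_nonneg (by linarith) (Real.exp_pos _).le
      linarith
    · have h1 := Real.rpow_le_rpow hv0.le hv2 hr.le
      have h2 := hC |u| hua.le
      have h3 : 0 ≤ |u| ^ (α - 1) := Real.rpow_nonneg hua.le _
      linarith
  have hnn : 0 ≤ (n : ℝ) ^ (1 - α) * coeff (-α) (lam / n) i := by
    rw [coeff_neg_eq]
    have := multichoose_nonneg hα i
    positivity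
  rw [Real.enorm_eq_ofReal hnn, domFn]
  refine ENNReal.ofReal_le_ofReal (hcoef.trans ?_)
  have hup : 0 ≤ |u| ^ (α - 1) := Real.rpow_nonneg hua.le _
  have hE : Real.exp (-(lam * |u|)) = Real.exp (-(lam / 2 * |u|)) * Real.exp (-(lam / 2 * |u|)) := by
    rw [← Real.exp_add]; congr 1; ring
  have hE1 : Real.exp (lam / 2 * |u|) * Real.exp (-(lam / 2 * |u|)) = 1 := by
    rw [← Real.exp_add]; simp
  have hE2 : Real.exp (-(lam / 2 * |u|)) ≤ 1 := by
    rw [Real.exp_le_one_iff]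
    have : 0 ≤ lam / 2 * |u| := by positivity
    linarith
  set e := Real.exp (-(lam / 2 * |u|)) with he
  have he0 : 0 < e := Real.exp_pos _
  calc K * v ^ (α - 1) * Real.exp (-(lam / n * i))
      ≤ K * (|u| ^ (α - 1) + C * Real.exp (lam / 2 * |u|)) *
        (Real.exp lam * Real.exp (-(lam * |u|))) := by gcongr
    _ = K * Real.exp lam * ((|u| ^ (α - 1) * e + C * (Real.exp (lam / 2 * |u|) * e)) * e) := by
        rw [hE]; ring
    _ = K * Real.exp lam * ((|u| ^ (α - 1) * e + C) * e) := by rw [hE1, mul_one]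
    _ ≤ K * Real.exp lam * ((C * |u| ^ (α - 1) + C) * e) := by
        refine mul_le_mul_of_nonneg_left (mul_le_mul_of_nonneg_right ?_ he0.le) (by positivity)
        have h1 := mul_le_of_le_one_right hup hE2
        have h2 := le_mul_of_one_le_left hup hC1
        linarith
    _ = K * Real.exp lam * C * ((|u| ^ (α - 1) + 1) * e) := by ring

/-- The same function dominates the limit kernel, thanks to `1 ≤ K`, so one increment bound serves
the weights and the limit. -/
lemma enorm_temperedKernel_le {K α lam : ℝ} (hK : 1 ≤ K) (hlam : 0 < lam) (s y : ℝ) :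
    ‖temperedKernel α lam s y‖ₑ ≤ domFn K α lam (s - y) := by
  unfold temperedKernel
  split_ifs with h
  swap
  · simp
  have hr : 0 ≤ (s - y) ^ (α - 1) := Real.rpow_nonneg h.le _
  rw [Real.enorm_eq_ofReal (by positivity), domFn, abs_of_pos h]
  refine ENNReal.ofReal_le_ofReal ?_
  have h1 : Real.exp (-(lam * (s - y))) ≤ Real.exp (-(lam / 2 * (s - y))) := by
    rw [Real.exp_le_exp]; nlinarith
  calc (s - y) ^ (α - 1) * Real.exp (-(lam * (s - y)))
      ≤ ((s - y) ^ (α - 1) + 1) * Real.exp (-(lam / 2 * (s - y))) := by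
        gcongr; linarith
    _ ≤ _ := le_mul_of_one_le_left (by positivity) hK

/-- For `s < y` the index is eventually negative. For `s > y` the index `j n` satisfies `j n / n → s
- y`, and the binomial asymptotics apply once `n^(1-α)` is split as `(j n)^(1-α) (j n / n)^(α-1)`.
-/
lemma tendsto_stepKernel {α lam : ℝ} (hα : 0 < α) {s y : ℝ} (hsy : s ≠ y) :
    Tendsto (fun n : ℕ => stepKernel α lam n (⌊n * s⌋ - ⌊n * y⌋)) atTop
      (𝓝 ((Real.Gamma α)⁻¹ * temperedKernel α lam s y)) := by
  set u := s - y with hu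
  have hu0 : u ≠ 0 := sub_ne_zero.2 hsy
  unfold temperedKernel
  rw [← hu]
  rcases lt_or_gt_of_ne hu0 with hneg | hpos
  · rw [if_neg (not_lt.2 hneg.le), mul_zero]
    refine tendsto_const_nhds.congr' ?_
    have hlarge : Tendsto (fun n : ℕ => (n : ℝ) * (-u)) atTop atTop :=
      tendsto_natCast_atTop_atTop.atTop_mul_const (neg_pos.2 hneg)
    filter_upwards [hlarge.eventually_ge_atTop 1] with n hn
    have hb := (floor_sub_floor_bounds n s y).2
    rw [← hu] at hb
    have : ((⌊(n : ℝ) * s⌋ - ⌊(n : ℝ) * y⌋ : ℤ) : ℝ) < 0 := by nlinarith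
    have : (⌊(n : ℝ) * s⌋ - ⌊(n : ℝ) * y⌋ : ℤ) < 0 := by exact_mod_cast this
    rw [stepKernel, if_neg (not_le.2 this)]
  · rw [if_pos hpos]
    set j : ℕ → ℕ := fun n => (⌊(n : ℝ) * s⌋ - ⌊(n : ℝ) * y⌋).toNat with hj
    have hlarge : Tendsto (fun n : ℕ => (n : ℝ) * u) atTop atTop :=
      tendsto_natCast_atTop_atTop.atTop_mul_const hpos
    have hev : ∀ᶠ n : ℕ in atTop, 0 < n ∧ 0 ≤ ⌊(n : ℝ) * s⌋ - ⌊(n : ℝ) * y⌋ ∧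
        (n : ℝ) * u - 1 < j n ∧ (j n : ℝ) < n * u + 1 ∧ (0 : ℝ) < j n := by
      filter_upwards [hlarge.eventually_ge_atTop 1, eventually_gt_atTop 0] with n hn hn0
      obtain ⟨b1, b2⟩ := floor_sub_floor_bounds n s y
      rw [← hu] at b1 b2
      have h0 : (0 : ℝ) < ((⌊(n : ℝ) * s⌋ - ⌊(n : ℝ) * y⌋ : ℤ) : ℝ) := by linarith
      have h0' : 0 < (⌊(n : ℝ) * s⌋ - ⌊(n : ℝ) * y⌋ : ℤ) := by exact_mod_cast h0
      have hc : ((j n : ℕ) : ℝ) = ((⌊(n : ℝ) * s⌋ - ⌊(n : ℝ) * y⌋ : ℤ) : ℝ) := by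
        have : ((j n : ℕ) : ℤ) = ⌊(n : ℝ) * s⌋ - ⌊(n : ℝ) * y⌋ := Int.toNat_of_nonneg h0'.le
        rw [← this]; simp
      rw [hc]
      exact ⟨hn0, h0'.le, b1, b2, h0⟩
    have hjtop : Tendsto j atTop atTop := by
      rw [← tendsto_natCast_atTop_iff (R := ℝ)]
      refine tendsto_atTop_mono' _ ?_ (tendsto_atTop_add_const_right _ (-1) hlarge)
      filter_upwards [hev] with n hn
      linarith [hn.2.2.1]
    have hinv : Tendsto (fun n : ℕ => 1 / (n : ℝ)) atTop (𝓝 0) := tendsto_one_div_atTop_nhds_zero_nat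
    have hratio : Tendsto (fun n : ℕ => (j n : ℝ) / n) atTop (𝓝 u) := by
      have l1 : Tendsto (fun n : ℕ => u - 1 / (n : ℝ)) atTop (𝓝 u) := by
        simpa using tendsto_const_nhds.sub hinv
      have l2 : Tendsto (fun n : ℕ => u + 1 / (n : ℝ)) atTop (𝓝 u) := by
        simpa using tendsto_const_nhds.add hinv
      refine tendsto_of_tendsto_of_tendsto_of_le_of_le' l1 l2 ?_ ?_
      · filter_upwards [hev] with n hn
        have hn0 : (0 : ℝ) < n := by exact_mod_cast hn.1
        rw [le_div_iff₀ hn0, sub_mul, one_div, inv_mul_cancel₀ hn0.ne']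
        linarith [hn.2.2.1]
      · filter_upwards [hev] with n hn
        have hn0 : (0 : ℝ) < n := by exact_mod_cast hn.1
        rw [div_le_iff₀ hn0, add_mul, one_div, inv_mul_cancel₀ hn0.ne']
        linarith [hn.2.2.2.1]
    have h1 := (tendsto_multichoose_mul_rpow hα).comp hjtop
    have h2 := hratio.rpow_const (p := α - 1) (Or.inl hpos.ne')
    have h3 : Tendsto (fun n : ℕ => Real.exp (-(lam * ((j n : ℝ) / n)))) atTop
        (𝓝 (Real.exp (-(lam * u)))) :=
      (Real.continuous_exp.tendsto _).comp (hratio.const_mul lam).neg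
    refine (h1.mul (h2.mul h3)).congr' ?_
    filter_upwards [hev] with n hn
    have hn0 : (0 : ℝ) < n := by exact_mod_cast hn.1
    have hj0 : (0 : ℝ) < j n := hn.2.2.2.2
    rw [stepKernel, if_pos hn.2.1, coeff_neg_eq]
    change Ring.multichoose α (j n) * (j n : ℝ) ^ (1 - α) * _ =
      (n : ℝ) ^ (1 - α) * (Ring.multichoose α (j n) * Real.exp (-(lam / n * (j n : ℝ))))
    rw [Real.div_rpow hj0.le hn0.le, show α - 1 = -(1 - α) by ring, Real.rpow_neg hj0.le,
      Real.rpow_neg hn0.le, show lam / n * (j n : ℝ) = lam * ((j n : ℝ) / n) by ring]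
    have := (Real.rpow_pos_of_pos hj0 (1 - α)).ne'
    field_simp

/-! ### Partial sums as integrals -/

lemma ae_floor_eq (x : ℤ → ℝ) {k : ℕ} {a b : ℝ} (ha : (k : ℝ) ≤ a) (hab : a ≤ b) (hb : b ≤ k + 1) :
    ∀ᵐ u : ℝ, u ∈ Set.uIoc a b → x (⌊u⌋ + 1) = x (k + 1) := by
  filter_upwards [compl_mem_ae_iff.2 (measure_singleton ((k : ℝ) + 1))] with u hu hmem
  rw [Set.uIoc_of_le hab] at hmem
  have h1 : u < k + 1 := lt_of_le_of_ne (hmem.2.trans hb) hu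
  have : ⌊u⌋ = (k : ℤ) := by
    rw [Int.floor_eq_iff]
    push_cast
    exact ⟨ha.trans hmem.1.le, h1⟩
  rw [this]

lemma integral_floor_eq (x : ℤ → ℝ) {k : ℕ} {a b : ℝ} (ha : (k : ℝ) ≤ a) (hab : a ≤ b)
    (hb : b ≤ k + 1) :
    IntervalIntegrable (fun u => x (⌊u⌋ + 1)) volume a b ∧
      ∫ u in a..b, x (⌊u⌋ + 1) = (b - a) * x (k + 1) := by
  have h := ae_floor_eq x ha hab hb
  constructor
  · refine (intervalIntegrable_const (c := x (k + 1))).congr_ae ?_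
    rw [EventuallyEq, ae_restrict_iff' measurableSet_uIoc]
    filter_upwards [h] with u hu hm
    exact (hu hm).symm
  · rw [intervalIntegral.integral_congr_ae h, intervalIntegral.integral_const, smul_eq_mul]

/-- Linear interpolation integrates the step function; as an integral, the fractional last term
needs no separate treatment. -/
lemma partialSum_eq_integral (x : ℤ → ℝ) {t : ℝ} (ht : 0 ≤ t) :
    partialSum x t = ∫ u in (0 : ℝ)..t, x (⌊u⌋ + 1) := by
  have hstep : ∀ k : ℕ, IntervalIntegrable (fun u => x (⌊u⌋ + 1)) volume (k : ℝ) ((k + 1 : ℕ) : ℝ) ∧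
      ∫ u in (k : ℝ)..((k + 1 : ℕ) : ℝ), x (⌊u⌋ + 1) = x (k + 1) := by
    intro k
    have := integral_floor_eq x (k := k) (a := k) (b := ((k + 1 : ℕ) : ℝ)) le_rfl
      (by push_cast; linarith) (by push_cast; linarith)
    refine ⟨this.1, this.2.trans ?_⟩
    push_cast; ring
  have hlast := integral_floor_eq x (k := ⌊t⌋₊) (a := ⌊t⌋₊) (b := t) le_rfl (Nat.floor_le ht)
    (Nat.lt_floor_add_one t).le
  have hsum := intervalIntegral.sum_integral_adjacent_intervals (n := ⌊t⌋₊)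
    (a := fun k : ℕ => (k : ℝ)) fun k _ => (hstep k).1
  have hint := IntervalIntegrable.trans_iterate (n := ⌊t⌋₊)
    (a := fun k : ℕ => (k : ℝ)) fun k _ => (hstep k).1
  simp only [Nat.cast_zero] at hsum hint
  rw [← intervalIntegral.integral_add_adjacent_intervals hint hlast.1, ← hsum, hlast.2, partialSum]
  congr 1
  rw [Finset.sum_congr rfl fun k _ => (hstep k).2]
  generalize ⌊t⌋₊ = N
  induction N with
  | zero => simp
  | succ N ih =>
    rw [Finset.sum_Icc_succ_top (by omega), ih, Finset.sum_range_succ]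
    push_cast
    rfl

/-! ### The scaled partial sums as weighted sums of the noise -/

/-- The coefficients of the ARTFIMA series, extended by zero to `ℤ`. -/
def intCoeff (α μ : ℝ) (j : ℤ) : ℝ := if 0 ≤ j then coeff (-α) μ j.toNat else 0

lemma stepKernel_eq (α lam : ℝ) (n : ℕ) (j : ℤ) :
    stepKernel α lam n j = (n : ℝ) ^ (1 - α) * intCoeff α (lam / n) j := by
  unfold stepKernel intCoeff
  split_ifs <;> simp

/-- The integrated rescaled coefficients. -/
def cellKernel (α lam : ℝ) (n : ℕ) (t : ℝ) (i : ℤ) : ℝ :=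
  ∫ s in (0 : ℝ)..t, stepKernel α lam n (⌊(n : ℝ) * s⌋ - i)

/-- The weight of the noise variable `Z i` in the scaled partial sum at time `t`. -/
def weight (α lam : ℝ) (n : ℕ) (t : ℝ) (i : ℤ) : ℝ :=
  (n : ℝ) ^ (-(1 / 2) : ℝ) * cellKernel α lam n t (i - 1)

/-- The substitution `u = n s` contributes a factor `n`, and `1 - H = -1/2 + (1 - α)`. The shift to
`i - 1` comes from the `+ 1` in `⌊u⌋ + 1`. -/
lemma scaledPath_intCoeff {α lam H : ℝ} (hH : H = α + 1 / 2) {n : ℕ} (hn : 1 ≤ n)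
    (t : unitInterval) (i : ℤ) :
    (n : ℝ) ^ (-H) * partialSum (fun k => intCoeff α (lam / n) (k - i)) (n * (t : ℝ))
      = weight α lam n t i := by
  have hn0 : (0 : ℝ) < n := by exact_mod_cast hn
  rw [partialSum_eq_integral _ (mul_nonneg hn0.le t.2.1)]
  have h := intervalIntegral.smul_integral_comp_mul_left (a := 0) (b := (t : ℝ))
    (fun u => intCoeff α (lam / n) (⌊u⌋ + 1 - i)) (n : ℝ)
  rw [mul_zero, smul_eq_mul] at h
  rw [← h, weight, cellKernel]
  have e : ∀ s : ℝ, stepKernel α lam n (⌊(n : ℝ) * s⌋ - (i - 1))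
      = (n : ℝ) ^ (1 - α) * intCoeff α (lam / n) (⌊(n : ℝ) * s⌋ + 1 - i) := by
    intro s
    rw [stepKernel_eq]
    congr 2
    ring
  simp_rw [e]
  rw [intervalIntegral.integral_const_mul, ← mul_assoc, ← mul_assoc, ← Real.rpow_add hn0]
  congr 1
  nth_rewrite 2 [← Real.rpow_one (n : ℝ)]
  rw [← Real.rpow_add hn0]
  congr 1
  rw [hH]; ring

lemma hasSum_intCoeff {α μ : ℝ} {z : ℤ → ℝ} {k : ℤ}
    (h : Summable fun j : ℕ => coeff (-α) μ j * z (k - j)) :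
    HasSum (fun i : ℤ => intCoeff α μ (k - i) * z i) (temperedDiff (-α) μ z k) := by
  have hinj : Function.Injective fun j : ℕ => k - (j : ℤ) := fun a b hab => by
    simpa using hab
  rw [← hinj.hasSum_iff]
  · refine h.hasSum.congr_fun fun j => ?_
    simp [intCoeff]
  · intro i hi
    have : ¬ 0 ≤ k - i := fun h0 => hi ⟨(k - i).toNat, by simp [Int.toNat_of_nonneg h0]⟩
    rw [intCoeff, if_neg this, zero_mul]

lemma hasSum_partialSum {c : ℤ → ℤ → ℝ} {z x : ℤ → ℝ}
    (h : ∀ k, HasSum (fun i : ℤ => c k i * z i) (x k)) (t : ℝ) :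
    HasSum (fun i => partialSum (fun k => c k i) t * z i) (partialSum x t) := by
  have h1 := (hasSum_sum fun (k : ℕ) (_ : k ∈ Finset.Icc 1 ⌊t⌋₊) => h k).add
    ((h ((⌊t⌋₊ : ℤ) + 1)).mul_left (t - ⌊t⌋₊))
  refine h1.congr_fun fun i => ?_
  rw [partialSum, add_mul, Finset.sum_mul, mul_assoc]

lemma summable_coeff {α μ : ℝ} (hα : 0 < α) (hμ : 0 < μ) :
    Summable fun j : ℕ => |coeff (-α) μ j| := by
  obtain ⟨K, hK1, hK⟩ := exists_multichoose_le hα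
  obtain ⟨C, hC1, hC⟩ := exists_rpow_le_exp (α - 1) (half_pos hμ)
  have hgeo : Summable fun j : ℕ => K * (C + 1) * Real.exp (-(μ / 2)) ^ j :=
    (summable_geometric_of_lt_one (Real.exp_pos _).le
      (Real.exp_lt_one_iff.2 (by linarith))).mul_left _
  refine Summable.of_nonneg_of_le (fun _ => abs_nonneg _) (fun j => ?_) hgeo
  rw [coeff_neg_eq, abs_of_nonneg (mul_nonneg (multichoose_nonneg hα j) (Real.exp_pos _).le)]
  have h1 : ((j : ℝ) + 1) ^ (α - 1) ≤ (C + 1) * Real.exp (μ / 2 * j) := by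
    have hj : (0 : ℝ) ≤ j := Nat.cast_nonneg j
    have he : 1 ≤ Real.exp (μ / 2 * j) := Real.one_le_exp (by positivity)
    rcases le_or_gt (α - 1) 0 with hr | hr
    · have := Real.rpow_le_one_of_one_le_of_nonpos (x := (j : ℝ) + 1) (by linarith) hr
      nlinarith
    · have h2 := Real.rpow_le_rpow (by positivity) (by linarith : (j : ℝ) + 1 ≤ j + 2) hr.le
      have h3 := hC j hj
      nlinarith
  calc Ring.multichoose α j * Real.exp (-(μ * j))
      ≤ K * ((C + 1) * Real.exp (μ / 2 * j)) * Real.exp (-(μ * j)) := by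
        gcongr
        exact (hK j).trans (by gcongr)
    _ = K * (C + 1) * Real.exp (-(μ / 2)) ^ j := by
        rw [← Real.exp_nat_mul, mul_assoc, mul_assoc, mul_assoc, ← Real.exp_add]
        congr 4
        ring

/-! ### Sums over cells -/

lemma lintegral_comp_floor (g : ℤ → ENNReal) {n : ℕ} (hn : 1 ≤ n) :
    ∫⁻ y : ℝ, g ⌊(n : ℝ) * y⌋ = (n : ENNReal)⁻¹ * ∑' i, g i := by
  have hn0 : (0 : ℝ) < n := by exact_mod_cast hn
  have hset : ∀ i : ℤ, {y : ℝ | ⌊(n : ℝ) * y⌋ = i} = Set.Ico (i / n : ℝ) ((i + 1) / n) := by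
    intro i
    ext y
    simp only [Set.mem_ofPred_eq, Int.floor_eq_iff, Set.mem_Ico]
    rw [div_le_iff₀ hn0, lt_div_iff₀ hn0, mul_comm y]
  have hmeas : ∀ i : ℤ, MeasurableSet {y : ℝ | ⌊(n : ℝ) * y⌋ = i} := fun i => by
    rw [hset]; exact measurableSet_Ico
  have hg : ∀ y : ℝ, g ⌊(n : ℝ) * y⌋
      = ∑' i, Set.indicator {y : ℝ | ⌊(n : ℝ) * y⌋ = i} (fun _ => g i) y := by
    intro y
    rw [tsum_eq_single ⌊(n : ℝ) * y⌋]
    · simp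
    · intro i hi
      exact Set.indicator_of_notMem (fun h => hi (Eq.symm h)) _
  simp_rw [hg]
  rw [lintegral_tsum fun i => (measurable_const.indicator (hmeas i)).aemeasurable,
    ← ENNReal.tsum_mul_left]
  refine tsum_congr fun i => ?_
  rw [lintegral_indicator_const (hmeas i), hset, Real.volume_Ico, mul_comm]
  congr 1
  rw [← sub_div, add_sub_cancel_left, one_div, ENNReal.ofReal_inv_of_pos hn0, ENNReal.ofReal_natCast]

/-- Each cell `[i/n, (i+1)/n)` has length `1/n`, the square of the normalising factor, and the shift
by one is a bijection of `ℤ`. -/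
lemma tsum_enorm_sq_weight (F : ℤ → ℝ) {n : ℕ} (hn : 1 ≤ n) :
    ∑' i : ℤ, ‖(n : ℝ) ^ (-(1 / 2) : ℝ) * F (i - 1)‖ₑ ^ 2 = ∫⁻ y : ℝ, ‖F ⌊(n : ℝ) * y⌋‖ₑ ^ 2 := by
  have hn0 : (0 : ℝ) < n := by exact_mod_cast hn
  rw [lintegral_comp_floor (fun i => ‖F i‖ₑ ^ 2) hn, ← ENNReal.tsum_mul_left,
    ← (Equiv.subRight (1 : ℤ)).tsum_eq fun i => (n : ENNReal)⁻¹ * ‖F i‖ₑ ^ 2]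
  refine tsum_congr fun i => ?_
  rw [enorm_mul, mul_pow]
  congr 1
  rw [Real.enorm_eq_ofReal (by positivity), ← ENNReal.ofReal_pow (by positivity),
    ← Real.rpow_natCast, ← Real.rpow_mul hn0.le]
  norm_num
  rw [Real.rpow_neg_one, ENNReal.ofReal_inv_of_pos hn0, ENNReal.ofReal_natCast]

lemma summable_sq_of_tsum_enorm {ι : Type*} {F : ι → ℝ} (h : ∑' i, ‖F i‖ₑ ^ 2 ≠ ⊤) :
    Summable (fun i => F i ^ 2) ∧ ∑' i, F i ^ 2 = (∑' i, ‖F i‖ₑ ^ 2).toReal := by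
  have e : ∀ i, (‖F i‖ₑ ^ 2).toReal = F i ^ 2 := by intro i; simp
  constructor
  · have := ENNReal.summable_toReal h
    simpa only [e] using this
  · rw [ENNReal.tsum_toReal_eq fun i => by simp]
    exact tsum_congr fun i => (e i).symm

lemma enorm_sq_eq_ofReal (x : ℝ) : ‖x‖ₑ ^ 2 = ENNReal.ofReal (x ^ 2) := by
  rw [← sq_abs, ENNReal.ofReal_pow (abs_nonneg _), ← Real.norm_eq_abs, ofReal_norm]

/-! ### Estimates for the weights and for the limit kernel -/

lemma measurable_stepKernel (α lam : ℝ) (n : ℕ) (y : ℝ) :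
    Measurable fun s : ℝ => stepKernel α lam n (⌊n * s⌋ - ⌊n * y⌋) :=
  (measurable_from_top (f := fun j : ℤ => stepKernel α lam n (j - ⌊n * y⌋))).comp
    (Int.measurable_floor.comp (measurable_const_mul _))

lemma measurable_cellKernel (α lam : ℝ) (n : ℕ) (t : ℝ) :
    Measurable fun y : ℝ => cellKernel α lam n t ⌊n * y⌋ :=
  (measurable_from_top (f := fun j : ℤ => cellKernel α lam n t j)).comp
    (Int.measurable_floor.comp (measurable_const_mul _))

lemma measurable_temperedKernel (α lam : ℝ) :
    Measurable fun p : ℝ × ℝ => temperedKernel α lam p.1 p.2 := by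
  unfold temperedKernel
  refine Measurable.ite (measurableSet_lt measurable_const (by fun_prop)) ?_ measurable_const
  fun_prop

lemma thpKernel_eq {α lam H : ℝ} (hH : H = α + 1 / 2) (t y : ℝ) :
    thpKernel H lam t y = ∫ s in (0 : ℝ)..t, temperedKernel α lam s y := by
  unfold thpKernel temperedKernel
  have : H - 3 / 2 = α - 1 := by rw [hH]; ring
  rw [this]

lemma stronglyMeasurable_thpKernel {α lam H : ℝ} (hH : H = α + 1 / 2) {t : ℝ} (ht : 0 ≤ t) :
    StronglyMeasurable (thpKernel H lam t) := by
  have h : thpKernel H lam t = fun y => ∫ s in Set.Ioc 0 t, temperedKernel α lam s y := by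
    ext y
    rw [thpKernel_eq hH, intervalIntegral.integral_of_le ht]
  rw [h]
  have hm : StronglyMeasurable (Function.uncurry fun y s => temperedKernel α lam s y) :=
    ((measurable_temperedKernel α lam).comp measurable_swap).stronglyMeasurable
  exact hm.integral_prod_right

/-- The increments of the weights and of the limit kernel are small in mean square, uniformly
in the scale. -/
lemma exists_sq_increment_bound {α lam H : ℝ} (hα : 0 < α) (hlam : 0 < lam) (hH : H = α + 1 / 2) :
    ∃ C κ : ℝ, 0 ≤ C ∧ 0 < κ ∧
      (∀ n : ℕ, 1 ≤ n → ∀ s t : ℝ, ∑' i, ‖weight α lam n t i - weight α lam n s i‖ₑ ^ 2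
        ≤ ENNReal.ofReal (C * |t - s| ^ (1 + κ))) ∧
      (∀ s t : ℝ, ∫⁻ y, ‖thpKernel H lam t y - thpKernel H lam s y‖ₑ ^ 2
        ≤ ENNReal.ofReal (C * |t - s| ^ (1 + κ))) := by
  obtain ⟨K, hK1, hK⟩ := exists_enorm_stepKernel_le hα hlam
  have hK0 : 0 ≤ K := by linarith
  -- The exponent `q = 1 + α` works for every `α > 0`, as `q (α - 1) = α² - 1 > -1`.
  have hq : 1 < 1 + α := by linarith
  have hI := lintegral_domFn_ne_top (K := K) hK0 hα hlam
  have hIq := lintegral_domFn_rpow_ne_top (K := K) (α := α) hK0 hlam hq.le (by nlinarith)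
  have hh := measurable_domFn K α lam
  set A := (∫⁻ u, domFn K α lam u ^ (1 + α)) ^ (1 / (1 + α)) * ∫⁻ u, domFn K α lam u with hA
  have hAt : A ≠ ⊤ := ENNReal.mul_ne_top (ENNReal.rpow_ne_top_of_nonneg (by positivity) hIq) hI
  have hκ : 0 < 1 - 1 / (1 + α) := by
    rw [sub_pos, div_lt_one (by linarith)]; exact hq
  have hconv : ∀ s t : ℝ, A * ENNReal.ofReal |t - s| ^ (1 + (1 - 1 / (1 + α)))
      = ENNReal.ofReal (A.toReal * |t - s| ^ (1 + (1 - 1 / (1 + α)))) := by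
    intro s t
    rw [ENNReal.ofReal_mul ENNReal.toReal_nonneg, ENNReal.ofReal_toReal hAt,
      ENNReal.ofReal_rpow_of_nonneg (abs_nonneg _) (by linarith)]
  refine ⟨A.toReal, 1 - 1 / (1 + α), ENNReal.toReal_nonneg, hκ, fun n hn s t => ?_, fun s t => ?_⟩
  · have h1 := tsum_enorm_sq_weight
      (fun i => cellKernel α lam n t i - cellKernel α lam n s i) hn
    have h2 := lintegral_sq_increment_le hh hI hq
      (fun y => measurable_stepKernel α lam n y) (fun s y hsy => hK n hn s y hsy) s t
    rw [← hconv]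
    refine le_trans (le_of_eq ?_) (h1.le.trans h2)
    refine tsum_congr fun i => ?_
    rw [weight, weight, mul_sub]
  · have h2 := lintegral_sq_increment_le hh hI hq
      (G := temperedKernel α lam)
      (fun y => (measurable_temperedKernel α lam).comp (measurable_id.prodMk measurable_const))
      (fun s y _ => enorm_temperedKernel_le hK1 hlam s y) s t
    rw [← hconv]
    simpa only [thpKernel_eq hH] using h2

/-- Convergence of the squared weights of the finite linear combinations. -/
lemma tendsto_tsum_sq_weight {α lam H : ℝ} (hα : 0 < α) (hlam : 0 < lam) (hH : H = α + 1 / 2)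
    {N : ℕ} (τ : Fin N → unitInterval) (θ : Fin N → ℝ) :
    Tendsto (fun n : ℕ => ∑' i, ‖∑ l, θ l * weight α lam (n + 1) (τ l) i‖ₑ ^ 2) atTop
      (𝓝 (ENNReal.ofReal ((Real.Gamma α)⁻¹ ^ 2)
        * ∫⁻ y, ‖∑ l, θ l * thpKernel H lam (τ l) y‖ₑ ^ 2)) := by
  obtain ⟨K, hK1, hK⟩ := exists_enorm_stepKernel_le hα hlam
  have hI := lintegral_domFn_ne_top (K := K) (by linarith) hα hlam
  have h := tendsto_lintegral_sq_kernel (measurable_domFn K α lam) hI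
    (G := fun n s y => stepKernel α lam (n + 1) (⌊((n + 1 : ℕ) : ℝ) * s⌋ - ⌊((n + 1 : ℕ) : ℝ) * y⌋))
    (G' := fun s y => (Real.Gamma α)⁻¹ * temperedKernel α lam s y)
    (fun n y => measurable_stepKernel α lam (n + 1) y)
    (fun n t => measurable_cellKernel α lam (n + 1) t)
    (fun n s y hsy => hK (n + 1) (by omega) s y hsy)
    (fun s y hsy => (tendsto_add_atTop_iff_nat 1).2 (tendsto_stepKernel hα hsy)) τ θ
  have e1 : ∀ n : ℕ, ∑' i, ‖∑ l, θ l * weight α lam (n + 1) (τ l) i‖ₑ ^ 2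
      = ∫⁻ y : ℝ, ‖∑ l, θ l * cellKernel α lam (n + 1) (τ l) ⌊((n + 1 : ℕ) : ℝ) * y⌋‖ₑ ^ 2 := by
    intro n
    rw [← tsum_enorm_sq_weight
      (fun i => ∑ l, θ l * cellKernel α lam (n + 1) (τ l) i) (Nat.le_add_left 1 n)]
    refine tsum_congr fun i => ?_
    rw [Finset.mul_sum]
    congr 3
    ext l
    rw [weight]; ring
  have e2 : ∫⁻ y, ‖∑ l, θ l * ∫ u in (0 : ℝ)..τ l, (Real.Gamma α)⁻¹ * temperedKernel α lam u y‖ₑ ^ 2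
      = ENNReal.ofReal ((Real.Gamma α)⁻¹ ^ 2)
        * ∫⁻ y, ‖∑ l, θ l * thpKernel H lam (τ l) y‖ₑ ^ 2 := by
    rw [← lintegral_const_mul' _ _ ENNReal.ofReal_ne_top]
    refine lintegral_congr fun y => ?_
    rw [← enorm_sq_eq_ofReal, ← mul_pow, ← enorm_mul, Finset.mul_sum]
    congr 3
    ext l
    rw [intervalIntegral.integral_const_mul, thpKernel_eq hH]; ring
  rw [e2] at h
  exact h.congr fun n => (e1 n).symm

/-- Asymptotic negligibility of the weights: the integrated coefficients are bounded by the `L¹`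
norm of the dominating function. -/
lemma exists_abs_weight_le {α lam : ℝ} (hα : 0 < α) (hlam : 0 < lam) :
    ∃ M : ℝ, ∀ n : ℕ, 1 ≤ n → ∀ (t : ℝ) (i : ℤ),
      |weight α lam n t i| ≤ (n : ℝ) ^ (-(1 / 2) : ℝ) * M := by
  obtain ⟨K, hK1, hK⟩ := exists_enorm_stepKernel_le hα hlam
  have hI := lintegral_domFn_ne_top (K := K) (by linarith) hα hlam
  refine ⟨(∫⁻ u, domFn K α lam u).toReal, fun n hn t i => ?_⟩
  have hn0 : (0 : ℝ) < n := by exact_mod_cast hn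
  have h1 : ⌊(n : ℝ) * (((i - 1 : ℤ) : ℝ) / n)⌋ = i - 1 := by
    rw [mul_div_cancel₀ _ hn0.ne', Int.floor_intCast]
  have h2 : ‖cellKernel α lam n t (i - 1)‖ₑ ≤ ∫⁻ u, domFn K α lam u := by
    have h3 := enorm_intervalIntegral_le_windowMass
      (fun s hs => hK n hn s (((i - 1 : ℤ) : ℝ) / n) hs) 0 t
    rw [h1] at h3
    exact h3.trans ((setLIntegral_le_lintegral _ _).trans
      (lintegral_sub_right_eq_self (domFn K α lam) _).le)
  rw [weight, abs_mul, abs_of_pos (by positivity)]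
  gcongr
  simpa using ENNReal.toReal_mono hI h2

/-- The kernel at time `t` is its increment from time `0`. -/
lemma lintegral_sq_thpKernel_ne_top {α lam H : ℝ} (hα : 0 < α) (hlam : 0 < lam)
    (hH : H = α + 1 / 2) (t : ℝ) : ∫⁻ y, ‖thpKernel H lam t y‖ₑ ^ 2 ≠ ⊤ := by
  obtain ⟨C, κ, -, -, -, h⟩ := exists_sq_increment_bound hα hlam hH
  have h0 := h 0 t
  have : ∀ y, thpKernel H lam 0 y = 0 := fun y => by simp [thpKernel]
  simp only [this, sub_zero] at h0
  exact ne_top_of_le_ne_top ENNReal.ofReal_ne_top h0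

lemma memLp_thpKernel {α lam H : ℝ} (hα : 0 < α) (hlam : 0 < lam)
    (hH : H = α + 1 / 2) {t : ℝ} (ht : 0 ≤ t) (c : ℝ) :
    MemLp (thpKernel H lam t) 2 (ENNReal.ofReal c • (volume : Measure ℝ)) := by
  refine MemLp.smul_measure ⟨(stronglyMeasurable_thpKernel hH ht).aestronglyMeasurable, ?_⟩
    ENNReal.ofReal_ne_top
  rw [lt_top_iff_ne_top]
  intro htop
  apply lintegral_sq_thpKernel_ne_top hα hlam hH t
  rw [← sq_eLpNorm_two, htop]
  simp

/-! ### Moments and finite-dimensional limits of the scaled paths -/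

section Main

variable {Ω : Type*} [MeasurableSpace Ω] {P : Measure Ω} [IsProbabilityMeasure P] {Z : ℤ → Ω → ℝ}

lemma ae_summable_artfima {α μ : ℝ} (hα : 0 < α) (hμ : 0 < μ)
    (hident : ∀ j, IdentDistrib (Z j) (Z 0) P P) (hvar : MemLp (Z 0) 2 P) (k : ℤ) :
    ∀ᵐ ω ∂P, Summable fun j : ℕ => |coeff (-α) μ j * Z (k - j) ω| :=
  ae_summable_weighted hident hvar _ (fun j : ℕ => k - (j : ℤ)) (summable_coeff hα hμ)

/-- Only countably many series are involved, so one null set serves all `t`. -/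
lemma ae_hasSum_scaledPath {α lam H : ℝ} (hα : 0 < α) (hlam : 0 < lam) (hH : H = α + 1 / 2)
    (hident : ∀ j, IdentDistrib (Z j) (Z 0) P P) (hvar : MemLp (Z 0) 2 P) {n : ℕ} (hn : 1 ≤ n) :
    ∀ᵐ ω ∂P, ∀ t : unitInterval, HasSum (fun i => weight α lam n t i * Z i ω)
      (scaledPath H n (fun k => artfima α (lam / n) Z k ω) t) := by
  have hn0 : (0 : ℝ) < n := by exact_mod_cast hn
  filter_upwards [ae_all_iff.2 fun k => ae_summable_artfima hα (div_pos hlam hn0) hident hvar k]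
    with ω hω t
  have h1 := hasSum_partialSum (c := fun k i => intCoeff α (lam / n) (k - i))
    (z := fun i => Z i ω) (fun k => hasSum_intCoeff (hω k).of_abs) (n * (t : ℝ))
  refine (h1.mul_left ((n : ℝ) ^ (-H))).congr_fun fun i => ?_
  rw [← mul_assoc, scaledPath_intCoeff hH hn]

/-- The convention `0 ^ (-H) = 0` disposes of the term `n = 0`, so that the criterion's bounds hold
for every `n`. -/
lemma scaledPath_zero {H : ℝ} (hH : H ≠ 0) (x : ℤ → ℝ) (t : unitInterval) :
    scaledPath H 0 x t = 0 := by
  simp [scaledPath, Real.zero_rpow (neg_ne_zero.2 hH)]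

lemma aemeasurable_scaledPath {α lam H : ℝ} (hα : 0 < α) (hlam : 0 < lam) (hH : H = α + 1 / 2)
    (hident : ∀ j, IdentDistrib (Z j) (Z 0) P P) (hvar : MemLp (Z 0) 2 P) (n : ℕ)
    (t : unitInterval) :
    AEMeasurable (fun ω => scaledPath H n (fun k => artfima α (lam / n) Z k ω) t) P := by
  rcases Nat.eq_zero_or_pos n with rfl | hn
  · simp only [scaledPath_zero (show H ≠ 0 by linarith)]
    exact aemeasurable_const
  · refine aemeasurable_of_hasSum hident (w := weight α lam n t) ?_
    filter_upwards [ae_hasSum_scaledPath hα hlam hH hident hvar hn] with ω hω using hω t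

lemma lintegral_sq_scaledPath_sub_le {α lam H : ℝ} (hα : 0 < α) (hlam : 0 < lam)
    (hH : H = α + 1 / 2) (hindep : iIndepFun Z P) (hident : ∀ j, IdentDistrib (Z j) (Z 0) P P)
    (hmean : ∫ ω, Z 0 ω ∂P = 0) (hvar : MemLp (Z 0) 2 P) {C κ : ℝ} (hC : 0 ≤ C)
    (hbound : ∀ n : ℕ, 1 ≤ n → ∀ s t : ℝ, ∑' i, ‖weight α lam n t i - weight α lam n s i‖ₑ ^ 2
        ≤ ENNReal.ofReal (C * |t - s| ^ (1 + κ))) (n : ℕ) (s t : unitInterval) :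
    ∫⁻ ω, ENNReal.ofReal ((scaledPath H n (fun k => artfima α (lam / n) Z k ω) t
        - scaledPath H n (fun k => artfima α (lam / n) Z k ω) s) ^ 2) ∂P
      ≤ ENNReal.ofReal (Var[Z 0; P] * C * |(t : ℝ) - s| ^ (1 + κ)) := by
  rcases Nat.eq_zero_or_pos n with rfl | hn
  · simp [scaledPath_zero (show H ≠ 0 by linarith)]
  have hb := hbound n hn s t
  have hs := summable_sq_of_tsum_enorm (ne_top_of_le_ne_top ENNReal.ofReal_ne_top hb)
  have h := sq_eLpNorm_weighted_sum_le hindep hident hmean hvar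
    (W := fun ω => scaledPath H n (fun k => artfima α (lam / n) Z k ω) t
        - scaledPath H n (fun k => artfima α (lam / n) Z k ω) s) hs.1 (by
      filter_upwards [ae_hasSum_scaledPath hα hlam hH hident hvar hn] with ω hω
      refine ((hω t).sub (hω s)).congr_fun fun i => ?_
      ring)
  rw [sq_eLpNorm_two] at h
  simp_rw [enorm_sq_eq_ofReal] at h
  refine h.trans (ENNReal.ofReal_le_ofReal ?_)
  rw [mul_assoc]
  refine mul_le_mul_of_nonneg_left ?_ (variance_nonneg _ _)
  rw [hs.2]
  exact ENNReal.toReal_le_of_le_ofReal (by positivity) hb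

lemma tendsto_charFun_scaledPath {α lam H : ℝ} (hα : 0 < α) (hlam : 0 < lam)
    (hH : H = α + 1 / 2) (hindep : iIndepFun Z P) (hident : ∀ j, IdentDistrib (Z j) (Z 0) P P)
    (hmean : ∫ ω, Z 0 ω ∂P = 0) (hvar : MemLp (Z 0) 2 P) {N : ℕ} (τ : Fin N → unitInterval)
    (θ : Fin N → ℝ)
    (hfin : ∫⁻ y, ‖∑ l, θ l * thpKernel H lam (τ l) y‖ₑ ^ 2 ≠ ⊤) :
    Tendsto (fun n : ℕ => charFun (P.map fun ω =>
        ∑ l, θ l * scaledPath H n (fun k => artfima α (lam / n) Z k ω) (τ l)) 1) atTop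
      (𝓝 (Complex.exp (-((Var[Z 0; P] / Real.Gamma α ^ 2
        * (∫⁻ y, ‖∑ l, θ l * thpKernel H lam (τ l) y‖ₑ ^ 2).toReal / 2 : ℝ))))) := by
  rw [← tendsto_add_atTop_iff_nat 1]
  obtain ⟨M, hM⟩ := exists_abs_weight_le hα hlam
  have hlim := tendsto_tsum_sq_weight hα hlam hH τ θ
  set V := ENNReal.ofReal ((Real.Gamma α)⁻¹ ^ 2)
        * ∫⁻ y, ‖∑ l, θ l * thpKernel H lam (τ l) y‖ₑ ^ 2 with hV
  have hVt : V ≠ ⊤ := ENNReal.mul_ne_top ENNReal.ofReal_ne_top hfin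
  have hev : ∀ᶠ n : ℕ in atTop,
      ∑' i, ‖∑ l, θ l * weight α lam (n + 1) (τ l) i‖ₑ ^ 2 ≠ ⊤ := by
    filter_upwards [hlim.eventually_lt_const hVt.lt_top] with n hn using hn.ne
  have key := tendsto_charFun_weighted_sum hindep hident hmean hvar
    (w := fun n i => ∑ l, θ l * weight α lam (n + 1) (τ l) i)
    (W := fun n ω =>
      ∑ l, θ l * scaledPath H (n + 1) (fun k => artfima α (lam / (n + 1 : ℕ)) Z k ω) (τ l))
    (b := fun n => ∑ l, |θ l| * (((n + 1 : ℕ) : ℝ) ^ (-(1 / 2) : ℝ) * M)) (v := V.toReal)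
    (by filter_upwards [hev] with n hn using (summable_sq_of_tsum_enorm hn).1)
    (Eventually.of_forall fun n => by
      filter_upwards [ae_hasSum_scaledPath hα hlam hH hident hvar (Nat.le_add_left 1 n)] with ω hω
      refine (hasSum_sum fun (l : Fin N) (_ : l ∈ Finset.univ) =>
        (hω (τ l)).mul_left (θ l)).congr_fun fun i => ?_
      rw [Finset.sum_mul]
      exact Finset.sum_congr rfl fun l _ => by ring)
    (Eventually.of_forall fun n i => by
      refine (Finset.abs_sum_le_sum_abs _ _).trans (Finset.sum_le_sum fun l _ => ?_)
      rw [abs_mul]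
      exact mul_le_mul_of_nonneg_left (hM (n + 1) (Nat.le_add_left 1 n) _ i) (abs_nonneg _))
    (by
      have h1 : Tendsto (fun n : ℕ => ((n + 1 : ℕ) : ℝ) ^ (-(1 / 2) : ℝ)) atTop (𝓝 0) :=
        ((tendsto_rpow_neg_atTop (by norm_num : (0 : ℝ) < 1 / 2)).comp
          tendsto_natCast_atTop_atTop).comp (tendsto_add_atTop_nat 1)
      have h2 := tendsto_finsetSum Finset.univ fun (l : Fin N) _ =>
        (h1.mul_const M).const_mul |θ l|
      simpa using h2)
    (by
      refine ((ENNReal.tendsto_toReal hVt).comp hlim).congr' ?_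
      filter_upwards [hev] with n hn using (summable_sq_of_tsum_enorm hn).2.symm) 1
  have e : Var[Z 0; P] * 1 ^ 2 * V.toReal / 2 = Var[Z 0; P] / Real.Gamma α ^ 2
        * (∫⁻ y, ‖∑ l, θ l * thpKernel H lam (τ l) y‖ₑ ^ 2).toReal / 2 := by
    rw [hV, ENNReal.toReal_mul, ENNReal.toReal_ofReal (sq_nonneg _), inv_pow]
    ring
  rw [e] at key
  exact key

end Main

/-! ### Moments of the limit process -/

section Limit

variable {Ω : Type*} [MeasurableSpace Ω] {P : Measure Ω} [IsProbabilityMeasure P]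
  {B : Set ℝ → Ω → ℝ} {c : ℝ}

lemma sq_eLpNorm_two_smul (f : ℝ → ℝ) :
    eLpNorm f 2 (ENNReal.ofReal c • (volume : Measure ℝ)) ^ 2
      = ENNReal.ofReal c * ∫⁻ y, ‖f y‖ₑ ^ 2 := by
  rw [sq_eLpNorm_two, lintegral_smul_measure, smul_eq_mul]

lemma lintegral_sq_wiener_sub_le {H lam : ℝ}
    (hB : IsGaussianRandomMeasure B (ENNReal.ofReal c • (volume : Measure ℝ)) P) (hc : 0 ≤ c)
    {W : unitInterval → Ω → ℝ} (hW : ∀ t : unitInterval, IsWienerIntegral B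
      (ENNReal.ofReal c • (volume : Measure ℝ)) P (thpKernel H lam t) (W t)) {C κ : ℝ}
    (hbound : ∀ s t : ℝ, ∫⁻ y, ‖thpKernel H lam t y - thpKernel H lam s y‖ₑ ^ 2
        ≤ ENNReal.ofReal (C * |t - s| ^ (1 + κ))) (s t : unitInterval) :
    ∫⁻ ω, ENNReal.ofReal ((W t ω - W s ω) ^ 2) ∂P
      ≤ ENNReal.ofReal (c * C * |(t : ℝ) - s| ^ (1 + κ)) := by
  have h := congrArg (· ^ 2) (((hW t).sub hB (hW s)).eLpNorm_eq hB)
  rw [sq_eLpNorm_two, sq_eLpNorm_two_smul] at h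
  simp_rw [enorm_sq_eq_ofReal (W t _ - W s _)] at h
  rw [h, mul_assoc, ENNReal.ofReal_mul hc]
  gcongr
  exact hbound s t

end Limit

end TemperedFractional

end

open TemperedFractional in
theorem theorem5p4
    {Ω : Type*} [MeasurableSpace Ω] (P : Measure Ω) [IsProbabilityMeasure P]
    {Ω' : Type*} [MeasurableSpace Ω'] (P' : Measure Ω') [IsProbabilityMeasure P']
    (α lam H : ℝ) (hα : 0 < α) (hlam : 0 < lam) (hH : H = α + 1 / 2)
    -- the noise: i.i.d., mean zero, finite variance
    (Z : ℤ → Ω → ℝ) (hindep : iIndepFun Z P) (hident : ∀ j, IdentDistrib (Z j) (Z 0) P P)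
    (hmean : ∫ ω, Z 0 ω ∂P = 0) (hvar : MemLp (Z 0) 2 P)
    -- the Gaussian random measure, with control measure `(Var Z₀ / Γ(α)²) dx`
    (m : Measure ℝ)
    (hm : m = ENNReal.ofReal (variance (Z 0) P / Real.Gamma α ^ 2) • (volume : Measure ℝ))
    (B : Set ℝ → Ω' → ℝ) (hB : IsGaussianRandomMeasure B m P') :
    -- the series that define the ARTFIMA variables converge absolutely almost surely
    (∀ n : ℕ, 1 ≤ n → ∀ k : ℤ, ∀ᵐ ω ∂P,
      Summable fun j : ℕ => |coeff (-α) (lam / n) j * Z (k - j) ω|) ∧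
    -- the limit process exists as a random element of `C[0,1]`
    (∃ ζ : Ω' → C(unitInterval, ℝ), IsTHP B m P' H lam ζ) ∧
    -- weak convergence in `C[0,1]`
    (∀ ζ : Ω' → C(unitInterval, ℝ), IsTHP B m P' H lam ζ →
      TendstoInDistribution
        (fun (n : ℕ) (ω : Ω) => scaledPath H n (fun k => artfima α (lam / n) Z k ω))
        atTop ζ (fun _ => P) P') := by
  subst hm
  have hV0 : 0 ≤ Var[Z 0; P] := variance_nonneg _ _
  set c := Var[Z 0; P] / Real.Gamma α ^ 2 with hc
  have hc0 : 0 ≤ c := by positivity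
  obtain ⟨C, κ, hC, hκ, hbw, hbk⟩ := exists_sq_increment_bound hα hlam hH
  -- The criterion wants one constant for the scaled paths (factor `Var Z₀`) and for the limit
  -- (factor `c`); the sum of the two factors covers both.
  have hmono : ∀ {a : ℝ}, a ≤ Var[Z 0; P] + c → ∀ s t : unitInterval,
      ENNReal.ofReal (a * C * |(t : ℝ) - s| ^ (1 + κ))
        ≤ ENNReal.ofReal ((Var[Z 0; P] + c) * C * |(t : ℝ) - s| ^ (1 + κ)) := by
    intro a ha s t
    refine ENNReal.ofReal_le_ofReal ?_
    gcongr
  refine ⟨fun n hn k => ?_, ?_, fun ζ hζ => ?_⟩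
  · exact ae_summable_artfima hα (div_pos hlam (by exact_mod_cast hn)) hident hvar k
  · have hex : ∀ t : unitInterval, ∃ Y : Ω' → ℝ, IsWienerIntegral B
        (ENNReal.ofReal c • (volume : Measure ℝ)) P' (thpKernel H lam t) Y := fun t =>
      exists_isWienerIntegral hB (memLp_thpKernel hα hlam hH t.2.1 c)
    choose W hW using hex
    obtain ⟨ζ, hζ⟩ := exists_continuous_modification (fun t => (hW t).2.1.1.aemeasurable)
      (mul_nonneg hc0 hC) hκ (lintegral_sq_wiener_sub_le hB hc0 hW hbk)
    exact ⟨ζ, fun t => (hW t).congr_ae (hζ t).symm⟩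
  · refine tendstoInDistribution_of_moment_bound
      (fun n t => aemeasurable_scaledPath hα hlam hH hident hvar n t)
      (fun t => (hζ t).2.1.1.aemeasurable) (C := (Var[Z 0; P] + c) * C) (by positivity) hκ
      (fun n s t => (lintegral_sq_scaledPath_sub_le hα hlam hH hindep hident hmean hvar hC hbw
        n s t).trans (hmono (by linarith) s t))
      (fun s t => (lintegral_sq_wiener_sub_le hB hc0 hζ hbk s t).trans (hmono (by linarith) s t))
      fun N τ θ => ?_
    have hWs := IsWienerIntegral.sum hB Finset.univ (fun l _ => hζ (τ l)) θ
    have hfin : ∫⁻ y, ‖∑ l, θ l * thpKernel H lam (τ l) y‖ₑ ^ 2 ≠ ⊤ := by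
      -- Finiteness is needed for Lebesgue measure itself: if the noise is degenerate then `c = 0`,
      -- and the control measure carries no information.
      have h1 : MemLp (fun y => ∑ l, θ l * thpKernel H lam (τ l) y) 2 (volume : Measure ℝ) := by
        refine memLp_finsetSum _ fun l _ => ?_
        have := memLp_thpKernel hα hlam hH (τ l).2.1 1
        rw [ENNReal.ofReal_one, one_smul] at this
        exact this.const_mul _
      rw [← sq_eLpNorm_two]
      exact ENNReal.pow_ne_top h1.2.ne
    have h1 := tendsto_charFun_scaledPath hα hlam hH hindep hident hmean hvar τ θ hfin
    rw [hWs.charFun_eq hB]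
    have e : (eLpNorm (fun y => ∑ l, θ l * thpKernel H lam (τ l) y) 2
        (ENNReal.ofReal c • (volume : Measure ℝ))).toReal ^ 2 * 1 ^ 2 / 2
        = c * (∫⁻ y, ‖∑ l, θ l * thpKernel H lam (τ l) y‖ₑ ^ 2).toReal / 2 := by
      rw [← ENNReal.toReal_pow, sq_eLpNorm_two_smul, ENNReal.toReal_mul,
        ENNReal.toReal_ofReal hc0]
      ring
    rw [e]
    exact h1
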